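/- **Setting.** Let $(\Omega,\mathcal F,P)$ be a probability space, $\mathcal G\subset\mathcal F$ a sub-$\sigma$-field, $\mathbb T\subset\mathbb R$ with $\sup\mathbb T=\infty$ (all limits are as $T\to\infty$ in $\mathbb T$), $\Theta\subset\mathbb R^{p}$ and $\mathcal T\subset\mathbb R^{q}$ compact, and $\theta^*\in\Theta$. Let $\mathcal N\subset\mathbb R^p$ be a bounded open set such that $\Theta\cap\{|\theta-\theta^*|<\delta\}\subset\overline{\mathcal N}$ for some $\delta>0$, and $t\theta+(1-t)\theta^*\in\mathcal N$ for all $\theta\in\mathcal N$, $0<t\le1$. For $T\in\mathbb T$ let $\mathbb H_T:\Omega\times\Theta\times\mathcal T\to\mathbb R$ be a random field, continuous on $\Theta\times\mathcal T$ for each $\omega$, which extends to a random field that is continuous on $\overline{\mathcal N}\times\mathcal T$ for each $\omega$ and such that, for all $\omega$ and $\tau$, $\mathbb H_T(\omega,\cdot,\tau)$ is $C^2$ in $\mathcal N$ with first and second derivatives extending continuously to $\overline{\mathcal N}$; $\partial_\theta\mathbb H_T$ and $\partial_\theta^2\mathbb H_T$ denote these extensions. Let $a_T\in GL(p)$ be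 deterministic with $\|a_T\|:=\mathrm{Tr}(a_Ta_T')^{1/2}\to0$, and let $b_T=\lambda_{\min}[(a_T'a_T)^{-1}]$. Let $\hat\tau_T$ be arbitrary $\mathcal T$-valued random variables, and let $\hat\theta_T$ be $\Theta$-valued random variables that asymptotically maximize $\mathbb H_T(\cdot,\hat\tau_T)$ on $\Theta$, i.e. $\sup_{\theta\in\Theta}\mathbb H_T(\theta,\hat\tau_T)-\mathbb H_T(\hat\theta_T,\hat\tau_T)\to0$ in probability (in particular, $\hat\theta_T$ may be a maximizer with probability tending to one). Put $\hat u_T=a_T^{-1}(\hat\theta_T-\theta^*)$. Let $\Delta$ be an $\mathbb R^p$-valued random variable, $\Gamma$ a $\mathcal G$-measurable random $p\times p$ matrix, and $\mathbb Y:\Omega\times\Theta\to\mathbb R$ a continuous random field. Write $\Delta_T(\tau)=a_T'\partial_\theta\mathbb H_T(\theta^*,\tau)$, $$U_T=\{u\in\mathbb R^p:\theta^*+a_Tu\in\Theta\},\qquad U=\bigcap_{\delta>0}\bigcup_{N\ge1}\bigcap_{T\ge N}U_T^{\delta},\qquad A^\delta=\{x:\inf_{y\in A}|x-y|<\delta\}.$$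 $Y_T\to^{d_s(\mathcal G)}Y$ (stable convergence) means $E[f(Y_T)Z]\to E[f(Y)Z]$ for all bounded continuous $f$ and all bounded $\mathcal G$-measurable $Z$. Suprema over $\tau$ and $\theta$ need not be measurable; convergence of them in probability is understood with outer probability. **Assumptions.** - [B1] $\sup_{\theta\in\Theta,\tau\in\mathcal T}\big|b_T^{-1}(\mathbb H_T(\theta,\tau)-\mathbb H_T(\theta^*,\tau))-\mathbb Y(\theta)\big|\to^P0$, and almost surely $\mathbb Y(\theta)<0$ for all $\theta\in\Theta\setminus\{\theta^*\}$. - [B2] For some $\tau_0\in\mathcal T$, $\sup_{\tau\in\mathcal T}|\Delta_T(\tau)-\Delta_T(\tau_0)|\to^P0$ and $\Delta_T(\tau_0)\to^{d_s(\mathcal G)}\Delta$. Moreover, for every positive $\delta_T\to0$, $\sup\{\|a_T'\partial_\theta^2\mathbb H_T(\theta,\tau)a_T+\Gamma\|:\theta\in\overline{\mathcal N},\ |\theta-\theta^*|<\delta_T,\ \tau\in\mathcal T\}\to^P0$. - [B3] $\Gamma$ is almost surely positive definite. - [A3] $\bigcap_{N\ge1}\overline{\bigcup_{T\ge N}U_T}\subset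 U$. - [A4] With $\mathbb Z(u)=\exp\{\Delta[u]-\frac12\Gamma[u,u]\}$, $\hat u$ is a $U$-valued random variable such that, almost surely, $\mathbb Z(\hat u)=\sup_U\mathbb Z$ and $\mathbb Z(u)<\mathbb Z(\hat u)$ for all $u\in U$ with $u\ne\hat u$. **Conclusion.** $\hat u_T=a_T^{-1}(\hat\theta_T-\theta^*)\to^{d_s(\mathcal G)}\hat u$. Moreover, let $\mathbb V_T(u)=\exp\{\Delta_T(\hat\tau_T)[u]-\frac12\Gamma[u,u]\}$ and assume [A5]: for some $T_0\in\mathbb T$, $(\hat v_T)_{T\ge T_0,\,T\in\mathbb T}$ is a tight family of $U$-valued random variables such that, for each $T\ge T_0$, almost surely $\mathbb V_T(\hat v_T)=\sup_U\mathbb V_T$. Then $\hat u_T-\hat v_T=o_P(1)$. -/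

import Mathlib

open Set Filter Topology MeasureTheory
open scoped ENNReal BoundedContinuousFunction Matrix

noncomputable section

/-- Stable convergence with respect to the sub-σ-field `𝒢`: for every bounded continuous `f` on `S`
and every bounded `𝒢`-measurable `Z`, `E[f (Y i) Z] → E[f Y₀ Z]` along `l`. -/
def StableTendsto {ι Ω S : Type*} [TopologicalSpace S] (𝒢 : MeasurableSpace Ω)
    [mΩ : MeasurableSpace Ω] (μ : Measure Ω) (Y : ι → Ω → S) (l : Filter ι) (Y₀ : Ω → S) : Prop :=
  ∀ (f : S →ᵇ ℝ) (Z : Ω → ℝ), Measurable[𝒢] Z → (∃ C : ℝ, ∀ ω, |Z ω| ≤ C) →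
    Tendsto (fun i => ∫ ω, f (Y i ω) * Z ω ∂μ) l (𝓝 (∫ ω, f (Y₀ ω) * Z ω ∂μ))

/-- Convergence to zero in (outer) probability of `[0, ∞]`-valued functions, used for suprema, which
are taken in `[0, ∞]`. -/
def TendstoZeroInProb {ι Ω : Type*} [MeasurableSpace Ω] (μ : Measure Ω) (X : ι → Ω → ℝ≥0∞)
    (l : Filter ι) : Prop :=
  ∀ ε : ℝ≥0∞, 0 < ε → Tendsto (fun i => μ {ω | ε ≤ X i ω}) l (𝓝 0)

/-- The matrix norm `Tr(A Aᵀ)^{1/2}`. -/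
def frobNorm {p : ℕ} (A : Matrix (Fin p) (Fin p) ℝ) : ℝ :=
  Real.sqrt (Matrix.trace (A * Aᵀ))

/-- The smallest eigenvalue of a symmetric matrix. -/
def lambdaMin {p : ℕ} (A : Matrix (Fin p) (Fin p) ℝ) : ℝ :=
  sInf (spectrum ℝ A)

/-- The Hessian matrix of `f` at `x`. -/
def hessian {p : ℕ} (f : EuclideanSpace ℝ (Fin p) → ℝ) (x : EuclideanSpace ℝ (Fin p)) :
    Matrix (Fin p) (Fin p) ℝ :=
  Matrix.of fun i j =>
    fderiv ℝ (fderiv ℝ f) x (EuclideanSpace.single i 1) (EuclideanSpace.single j 1)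

/-- The class `C²` on the closure of an open set `N`: continuous on the closure, twice continuously
differentiable in `N`, and the derivatives extend continuously to the closure (equivalently, they
have limits, taken within `N`, at all points of the closure). -/
structure IsC2OnClosure {p : ℕ} (N : Set (EuclideanSpace ℝ (Fin p)))
    (f : EuclideanSpace ℝ (Fin p) → ℝ) : Prop where
  continuousOn : ContinuousOn f (closure N)
  contDiffOn : ContDiffOn ℝ 2 f N
  gradient_extends : ∀ x ∈ closure N, ∃ y, Tendsto (gradient f) (𝓝[N] x) (𝓝 y)
  hessian_extends : ∀ x ∈ closure N, ∃ y, Tendsto (hessian f) (𝓝[N] x) (𝓝 y)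

/-- The continuous extension of the gradient from `N` to the closure of `N`. -/
def gradExt {p : ℕ} (N : Set (EuclideanSpace ℝ (Fin p))) (f : EuclideanSpace ℝ (Fin p) → ℝ) :
    EuclideanSpace ℝ (Fin p) → EuclideanSpace ℝ (Fin p) :=
  extendFrom N (gradient f)

/-- The continuous extension of the Hessian matrix from `N` to the closure of `N`. -/
def hessExt {p : ℕ} (N : Set (EuclideanSpace ℝ (Fin p))) (f : EuclideanSpace ℝ (Fin p) → ℝ) :
    EuclideanSpace ℝ (Fin p) → Matrix (Fin p) (Fin p) ℝ :=
  extendFrom N (hessian f)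

/-- The rescaled parameter set `{u | θ* + A u ∈ Θ}`. -/
def localSet {p : ℕ} (Θ : Set (EuclideanSpace ℝ (Fin p))) (θs : EuclideanSpace ℝ (Fin p))
    (A : Matrix (Fin p) (Fin p) ℝ) : Set (EuclideanSpace ℝ (Fin p)) :=
  {u | θs + Matrix.toEuclideanLin A u ∈ Θ}

/-- `⋂_{δ > 0} ⋃_N ⋂_{T ≥ N} (U_T)^δ`, where `(U_T)^δ` is the open `δ`-neighbourhood of `U_T`. -/
def limitSet {p : ℕ} {𝕋 : Set ℝ} (UT : 𝕋 → Set (EuclideanSpace ℝ (Fin p))) :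
    Set (EuclideanSpace ℝ (Fin p)) :=
  ⋂ (δ : ℝ) (_ : 0 < δ), ⋃ N : ℕ, ⋂ (T : 𝕋) (_ : (N : ℝ) ≤ T), Metric.thickening δ (UT T)

/-- `⋂_N closure (⋃_{T ≥ N} U_T)`. -/
def outerLimitSet {p : ℕ} {𝕋 : Set ℝ} (UT : 𝕋 → Set (EuclideanSpace ℝ (Fin p))) :
    Set (EuclideanSpace ℝ (Fin p)) :=
  ⋂ N : ℕ, closure (⋃ (T : 𝕋) (_ : (N : ℝ) ≤ T), UT T)

/-- The field `exp (D[u] - ½ G[u, u])`. -/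
def quadField {p : ℕ} (D : EuclideanSpace ℝ (Fin p)) (G : Matrix (Fin p) (Fin p) ℝ)
    (u : EuclideanSpace ℝ (Fin p)) : ℝ :=
  Real.exp (inner ℝ D u - 1 / 2 * inner ℝ u (Matrix.toEuclideanLin G u))

/-- The normalized score `Aᵀ ∂_θ h(θ)`, with the derivative extended to the closure of `N`. -/
def scaledScore {p : ℕ} (N : Set (EuclideanSpace ℝ (Fin p))) (A : Matrix (Fin p) (Fin p) ℝ)
    (h : EuclideanSpace ℝ (Fin p) → ℝ) (θ : EuclideanSpace ℝ (Fin p)) :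
    EuclideanSpace ℝ (Fin p) :=
  Matrix.toEuclideanLin Aᵀ (gradExt N h θ)

end

/-! The proof is an argmax argument in which no large deviation estimate is needed. The contrast
condition makes `θhat` consistent: away from `θs` the limit `Y` is bounded above by a negative
constant off an event of small probability, while the optimization error stays negligible after
multiplication by `b_T⁻¹`, which tends to zero (`eventuallyProb_norm_sub_lt_of_contrast`).
Consistency in probability upgrades to a deterministic rate `δ₀ T → 0`
(`exists_rate_of_tendsto_prob`), and the Hessian condition may then be used on a shrinking ball that
contains `θhat` itself.

On that ball Taylor's formula replaces the increment of the field at `θs + a_T u` by `logQuad` with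
error `r/2 * ‖u‖²` (`abs_sub_sub_logQuad_le`). The error is relative to `‖u‖²`, so the coercivity of
`Γ` absorbs it even at the rescaled estimator, whose size is not yet known. This gives tightness.
Since the rescaled sets converge to `U = limitSet UT` on compacts in both directions, the rescaled
estimator is close to a near-maximizer over `U` of the quadratic field with score `D`
(`isAsympMaximizer_of_locally_quadratic`). The variables `vhat` have the same property.

It remains to pass to the limit for near-maximizers. For bounded continuous `g` on pairs,
`penalizedSup` is a continuous function of score and matrix that almost dominates `g` at any pair of
near-maximizers. Stable convergence, joint with the `𝒢`-measurable `Γ`, transfers it to the limit,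
where letting the penalty grow leaves `g (w, w)` by uniqueness of the maximizer `w`. This is
`eventually_integral_asympMaximizer_le`. Taking `g = ±f` of the first coordinate yields stable
convergence; taking the truncated distance, which vanishes on the diagonal, yields the asymptotic
equivalence with `vhat`. -/

/-- Real Euclidean space of dimension `p`. -/
abbrev Vec (p : ℕ) := EuclideanSpace ℝ (Fin p)

/-- Real square matrices of size `p`. -/
abbrev Mat (p : ℕ) := Matrix (Fin p) (Fin p) ℝ

/-- The quadratic polynomial `D[u] - ½ G[u, u]`, the logarithm of `quadField`. -/
noncomputable def logQuad {p : ℕ} (D : Vec p) (G : Mat p) (u : Vec p) : ℝ :=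
  inner ℝ D u - 1 / 2 * inner ℝ u (Matrix.toEuclideanLin G u)

lemma quadField_eq_exp_logQuad {p : ℕ} (D : Vec p) (G : Mat p) (u : Vec p) :
    quadField D G u = Real.exp (logQuad D G u) := rfl

/-! ### Linear algebra: Frobenius norm, coercivity and perturbation of quadratic fields. -/

lemma frobNorm_nonneg {p : ℕ} (A : Mat p) : 0 ≤ frobNorm A := Real.sqrt_nonneg _

lemma trace_mul_transpose_self {p : ℕ} (A : Mat p) :
    Matrix.trace (A * Aᵀ) = ∑ i, ∑ j, A i j ^ 2 := by
  simp [Matrix.trace, Matrix.mul_apply, sq]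

lemma sq_frobNorm {p : ℕ} (A : Mat p) : frobNorm A ^ 2 = ∑ i, ∑ j, A i j ^ 2 := by
  rw [frobNorm, trace_mul_transpose_self, Real.sq_sqrt]
  positivity

lemma continuous_frobNorm {p : ℕ} : Continuous (frobNorm : Mat p → ℝ) := by
  unfold frobNorm
  fun_prop

lemma norm_toEuclideanLin_le {p : ℕ} (A : Mat p) (u : Vec p) :
    ‖Matrix.toEuclideanLin A u‖ ≤ frobNorm A * ‖u‖ := by
  refine le_of_sq_le_sq ?_ (mul_nonneg (frobNorm_nonneg A) (norm_nonneg u))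
  rw [mul_pow, sq_frobNorm, EuclideanSpace.norm_sq_eq, EuclideanSpace.norm_sq_eq, Finset.sum_mul]
  refine Finset.sum_le_sum fun i _ => ?_
  simpa [Matrix.toLpLin_apply, Matrix.mulVec, dotProduct] using
    Finset.sum_mul_sq_le_sq_mul_sq Finset.univ (fun j => A i j) (fun j => u j)

lemma abs_inner_toEuclideanLin_le {p : ℕ} (A : Mat p) (u v : Vec p) :
    |inner ℝ u (Matrix.toEuclideanLin A v)| ≤ frobNorm A * ‖u‖ * ‖v‖ := by
  have h1 := abs_real_inner_le_norm u (Matrix.toEuclideanLin A v)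
  have h2 := mul_le_mul_of_nonneg_left (norm_toEuclideanLin_le A v) (norm_nonneg u)
  linarith

lemma inner_toEuclideanLin_transpose {p : ℕ} (A : Mat p) (x u : Vec p) :
    inner ℝ (Matrix.toEuclideanLin Aᵀ x) u = inner ℝ x (Matrix.toEuclideanLin A u) := by
  rw [← Matrix.conjTranspose_eq_transpose_of_trivial, Matrix.toEuclideanLin_conjTranspose_eq_adjoint,
    LinearMap.adjoint_inner_left]

lemma toEuclideanLin_mul {p : ℕ} (A B : Mat p) (u : Vec p) :
    Matrix.toEuclideanLin (A * B) u = Matrix.toEuclideanLin A (Matrix.toEuclideanLin B u) := by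
  simp [Matrix.toLpLin_apply]

lemma inner_conj_toEuclideanLin {p : ℕ} (A B : Mat p) (u : Vec p) :
    inner ℝ u (Matrix.toEuclideanLin (Aᵀ * B * A) u) =
      inner ℝ (Matrix.toEuclideanLin A u)
        (Matrix.toEuclideanLin B (Matrix.toEuclideanLin A u)) := by
  rw [toEuclideanLin_mul, toEuclideanLin_mul, real_inner_comm, inner_toEuclideanLin_transpose,
    real_inner_comm]

lemma toEuclideanLin_mul_inv_cancel {p : ℕ} {A : Mat p} (hA : IsUnit A.det) (u : Vec p) :
    Matrix.toEuclideanLin A (Matrix.toEuclideanLin A⁻¹ u) = u := by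
  rw [← toEuclideanLin_mul, Matrix.mul_nonsing_inv A hA]
  simp

lemma toEuclideanLin_inv_mul_cancel {p : ℕ} {A : Mat p} (hA : IsUnit A.det) (u : Vec p) :
    Matrix.toEuclideanLin A⁻¹ (Matrix.toEuclideanLin A u) = u := by
  rw [← toEuclideanLin_mul, Matrix.nonsing_inv_mul A hA]
  simp

lemma continuous_toEuclideanLin {p : ℕ} :
    Continuous fun x : Mat p × Vec p => Matrix.toEuclideanLin x.1 x.2 := by
  simp only [Matrix.toLpLin_apply]
  fun_prop

lemma continuous_logQuad {p : ℕ} :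
    Continuous fun x : (Vec p × Mat p) × Vec p => logQuad x.1.1 x.1.2 x.2 := by
  have h : Continuous fun x : (Vec p × Mat p) × Vec p => Matrix.toEuclideanLin x.1.2 x.2 :=
    continuous_toEuclideanLin.comp (by fun_prop : Continuous fun x : (Vec p × Mat p) × Vec p =>
      (x.1.2, x.2))
  unfold logQuad
  exact (by fun_prop : Continuous fun x : (Vec p × Mat p) × Vec p => inner ℝ x.1.1 x.2).sub
    (continuous_const.mul (Continuous.inner (by fun_prop) h))

/-- An eigenvector `v` satisfies `v = c AᵀA v`; pairing with `v` gives `‖v‖² = c ‖A v‖² ≤ c ‖A‖²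
‖v‖²`. -/
lemma sq_norm_le_of_mem_spectrum {p : ℕ} {A : Mat p} (hA : IsUnit A.det) {c : ℝ}
    (hc : c ∈ spectrum ℝ (Aᵀ * A)⁻¹) : 1 ≤ c * frobNorm A ^ 2 := by
  rw [← Matrix.spectrum_toLpLin 2, ← Module.End.hasEigenvalue_iff_mem_spectrum] at hc
  obtain ⟨v, hv⟩ := hc.exists_hasEigenvector
  have hv0 := hv.2
  have hv1 : Matrix.toEuclideanLin (Aᵀ * A)⁻¹ v = c • v := hv.apply_eq_smul
  have hdet : IsUnit (Aᵀ * A).det := by simpa using hA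
  have h2 : v = c • Matrix.toEuclideanLin (Aᵀ * A) v := by
    rw [← map_smul, ← hv1, toEuclideanLin_mul_inv_cancel hdet]
  have h3 : ‖v‖ ^ 2 = c * ‖Matrix.toEuclideanLin A v‖ ^ 2 := by
    rw [← real_inner_self_eq_norm_sq, ← real_inner_self_eq_norm_sq, ← inner_toEuclideanLin_transpose,
      ← toEuclideanLin_mul, ← real_inner_smul_left, ← h2]
  have hpos : 0 < ‖v‖ ^ 2 := by positivity
  have hc0 : 0 ≤ c := by
    by_contra h
    nlinarith [sq_nonneg ‖Matrix.toEuclideanLin A v‖]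
  have h4 : ‖Matrix.toEuclideanLin A v‖ ^ 2 ≤ frobNorm A ^ 2 * ‖v‖ ^ 2 := by
    rw [← mul_pow]
    exact pow_le_pow_left₀ (norm_nonneg _) (norm_toEuclideanLin_le A v) 2
  have h5 := mul_le_mul_of_nonneg_left h4 hc0
  by_contra h
  nlinarith

/-- This yields `b_T⁻¹ → 0`, so an additive error in `H` remains negligible after the normalization
of the contrast. -/
lemma one_div_lambdaMin_mem_Icc {p : ℕ} {A : Mat p} (hA : IsUnit A.det) :
    1 / lambdaMin (Aᵀ * A)⁻¹ ∈ Icc 0 (frobNorm A ^ 2) := by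
  unfold lambdaMin
  rcases (spectrum ℝ (Aᵀ * A)⁻¹).eq_empty_or_nonempty with h | h
  -- Empty spectrum: `sInf ∅ = 0` and `1 / 0 = 0`, which still lies in the interval.
  · simp [h, sq_nonneg]
  · obtain ⟨c₀, hc₀⟩ := h
    have h0 := sq_norm_le_of_mem_spectrum hA hc₀
    have hf : 0 < frobNorm A ^ 2 := by
      rcases (sq_nonneg (frobNorm A)).lt_or_eq with h | h
      · exact h
      · rw [← h] at h0; norm_num at h0
    have h1 : 1 / frobNorm A ^ 2 ≤ sInf (spectrum ℝ (Aᵀ * A)⁻¹) :=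
      le_csInf ⟨c₀, hc₀⟩ fun c hc => by
        rw [div_le_iff₀ hf]; exact sq_norm_le_of_mem_spectrum hA hc
    have h2 : 0 < 1 / frobNorm A ^ 2 := by positivity
    refine ⟨by have := h2.trans_le h1; positivity, ?_⟩
    rw [div_le_iff₀ (h2.trans_le h1)]
    rw [div_le_iff₀ hf] at h1
    linarith

lemma Matrix.PosDef.exists_pos_mul_sq_norm_le {p : ℕ} {G : Mat p} (hG : G.PosDef) :
    ∃ c > 0, ∀ u : Vec p, c * ‖u‖ ^ 2 ≤ inner ℝ u (Matrix.toEuclideanLin G u) := by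
  have hcont : Continuous fun u : Vec p => inner ℝ u (Matrix.toEuclideanLin G u) :=
    continuous_id.inner (continuous_toEuclideanLin.comp (by fun_prop : Continuous fun u : Vec p =>
      (G, u)))
  have hpos : ∀ u : Vec p, u ≠ 0 → 0 < inner ℝ u (Matrix.toEuclideanLin G u) := by
    intro u hu
    have := hG.dotProduct_mulVec_pos (x := u.ofLp) (by simpa using hu)
    simpa [Matrix.toLpLin_apply, PiLp.inner_apply, dotProduct, mul_comm] using this
  -- The sphere is empty exactly when `p = 0`; otherwise the constant is the minimum of the form on
  -- the sphere, extended by homogeneity.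
  rcases (Metric.sphere (0 : Vec p) 1).eq_empty_or_nonempty with h | h
  · refine ⟨1, one_pos, fun u => ?_⟩
    have hu : u = 0 := by
      by_contra hu
      have : (‖u‖⁻¹ • u) ∈ Metric.sphere (0 : Vec p) 1 := by
        simp [norm_smul, hu]
      simp [h] at this
    simp [hu]
  · obtain ⟨w, hw, hmin⟩ := (isCompact_sphere (0 : Vec p) 1).exists_isMinOn h hcont.continuousOn
    have hw0 : w ≠ 0 := by rintro rfl; simp at hw
    refine ⟨_, hpos w hw0, fun u => ?_⟩
    rcases eq_or_ne u 0 with rfl | hu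
    · simp
    have hu' : (‖u‖⁻¹ • u) ∈ Metric.sphere (0 : Vec p) 1 := by simp [norm_smul, hu]
    have h1 := hmin hu'
    simp only [Set.mem_ofPred_eq, map_smul, inner_smul_left, inner_smul_right] at h1
    have hn : 0 < ‖u‖ := norm_pos_iff.2 hu
    have h2 := mul_le_mul_of_nonneg_right h1 (sq_nonneg ‖u‖)
    refine h2.trans_eq ?_
    simp
    field_simp

lemma abs_logQuad_sub_le_of_score {p : ℕ} (D D' : Vec p) (G : Mat p) (u : Vec p) :
    |logQuad D G u - logQuad D' G u| ≤ ‖D - D'‖ * ‖u‖ := by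
  have : logQuad D G u - logQuad D' G u = inner ℝ (D - D') u := by
    simp [logQuad, inner_sub_left]
  rw [this]
  exact abs_real_inner_le_norm _ _

lemma abs_logQuad_sub_le_of_matrix {p : ℕ} (D : Vec p) (G G' : Mat p) (u : Vec p) :
    |logQuad D G u - logQuad D G' u| ≤ 1 / 2 * (frobNorm (G - G') * ‖u‖ ^ 2) := by
  have : logQuad D G u - logQuad D G' u =
      - (1 / 2 * inner ℝ u (Matrix.toEuclideanLin (G - G') u)) := by
    simp [logQuad, inner_sub_right]
    ring
  rw [this, abs_neg, abs_mul, abs_of_pos (by norm_num : (0 : ℝ) < 1 / 2)]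
  have := abs_inner_toEuclideanLin_le (G - G') u u
  nlinarith

lemma abs_logQuad_sub_le_of_point {p : ℕ} {D : Vec p} {G : Mat p} {u v : Vec p} {L R : ℝ}
    (hD : ‖D‖ ≤ L) (hG : frobNorm G ≤ L) (hu : ‖u‖ ≤ R) (hv : ‖v‖ ≤ R) :
    |logQuad D G u - logQuad D G v| ≤ L * (1 + R) * ‖u - v‖ := by
  have hL : 0 ≤ L := (norm_nonneg D).trans hD
  have hR : 0 ≤ R := (norm_nonneg u).trans hu
  -- This splitting of the difference of quadratic forms does not require `G` to be symmetric.
  have : logQuad D G u - logQuad D G v = inner ℝ D (u - v)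
      - 1 / 2 * inner ℝ u (Matrix.toEuclideanLin G (u - v))
      - 1 / 2 * inner ℝ (u - v) (Matrix.toEuclideanLin G v) := by
    simp only [logQuad, inner_sub_right, inner_sub_left, map_sub]
    ring
  have h1 := abs_real_inner_le_norm D (u - v)
  have h2 := abs_inner_toEuclideanLin_le G u (u - v)
  have h3 := abs_inner_toEuclideanLin_le G (u - v) v
  have h4 : ‖D‖ * ‖u - v‖ ≤ L * ‖u - v‖ := by gcongr
  have h5 : frobNorm G * ‖u‖ * ‖u - v‖ ≤ L * R * ‖u - v‖ := by
    gcongr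
  have h6 : frobNorm G * ‖u - v‖ * ‖v‖ ≤ L * ‖u - v‖ * R := by
    have := frobNorm_nonneg G
    gcongr
  rw [this, abs_le]
  rw [abs_le] at h1 h2 h3
  constructor <;> nlinarith

/-! ### Convergence of the rescaled parameter sets on compacts. -/

lemma nonempty_coe_of_not_bddAbove {𝕋 : Set ℝ} (h𝕋 : ¬ BddAbove 𝕋) : Nonempty 𝕋 :=
  (nonempty_of_not_bddAbove h𝕋).to_subtype

lemma tendsto_coe_atTop_of_not_bddAbove {𝕋 : Set ℝ} (h𝕋 : ¬ BddAbove 𝕋) :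
    Tendsto (fun T : 𝕋 => (T : ℝ)) atTop atTop := by
  have := nonempty_coe_of_not_bddAbove h𝕋
  refine tendsto_atTop_atTop.2 fun b => ?_
  obtain ⟨T, hT, hbT⟩ := not_bddAbove_iff.1 h𝕋 b
  exact ⟨⟨T, hT⟩, fun S hS => hbT.le.trans hS⟩

lemma isClosed_limitSet {p : ℕ} {𝕋 : Set ℝ} (UT : 𝕋 → Set (Vec p)) : IsClosed (limitSet UT) := by
  refine isClosed_of_closure_subset fun x hx => ?_
  simp only [limitSet, mem_iInter, mem_iUnion]
  intro δ hδ
  obtain ⟨y, hy, hxy⟩ := Metric.mem_closure_iff.1 hx (δ / 2) (half_pos hδ)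
  simp only [limitSet, mem_iInter, mem_iUnion] at hy
  obtain ⟨N, hN⟩ := hy (δ / 2) (half_pos hδ)
  refine ⟨N, fun T hT => ?_⟩
  obtain ⟨z, hz, hyz⟩ := Metric.mem_thickening_iff.1 (hN T hT)
  exact Metric.mem_thickening_iff.2 ⟨z, hz, by linarith [dist_triangle x y z]⟩

lemma eventually_mem_thickening_of_mem_limitSet {p : ℕ} {𝕋 : Set ℝ} (h𝕋 : ¬ BddAbove 𝕋)
    {UT : 𝕋 → Set (Vec p)} {x : Vec p} (hx : x ∈ limitSet UT) {η : ℝ} (hη : 0 < η) :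
    ∀ᶠ T in atTop, x ∈ Metric.thickening η (UT T) := by
  simp only [limitSet, mem_iInter, mem_iUnion] at hx
  obtain ⟨N, hN⟩ := hx η hη
  filter_upwards [(tendsto_coe_atTop_of_not_bddAbove h𝕋).eventually_ge_atTop (N : ℝ)] with T hT
  exact hN T hT

lemma mem_limitSet_of_forall_mem {p : ℕ} {𝕋 : Set ℝ} {UT : 𝕋 → Set (Vec p)} {x : Vec p}
    (hx : ∀ T, x ∈ UT T) : x ∈ limitSet UT := by
  simp only [limitSet, mem_iInter, mem_iUnion]
  exact fun δ hδ => ⟨0, fun T _ => Metric.self_subset_thickening hδ _ (hx T)⟩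

/-- Pointwise approximation becomes uniform on `K` through a finite cover by balls of radius `η /
2`. -/
lemma eventually_forall_mem_compact_exists_dist_lt {p : ℕ} {𝕋 : Set ℝ} (h𝕋 : ¬ BddAbove 𝕋)
    {UT : 𝕋 → Set (Vec p)} {K : Set (Vec p)} (hK : IsCompact K) (hKU : K ⊆ limitSet UT) {η : ℝ}
    (hη : 0 < η) : ∀ᶠ T in atTop, ∀ x ∈ K, ∃ u ∈ UT T, dist x u < η := by
  obtain ⟨t, htK, hcov⟩ := hK.elim_nhds_subcover (fun x => Metric.ball x (η / 2))
    fun x _ => Metric.ball_mem_nhds x (half_pos hη)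
  have h : ∀ᶠ T in atTop, ∀ x ∈ t, x ∈ Metric.thickening (η / 2) (UT T) :=
    (Finset.eventually_all t).2 fun x hx =>
      eventually_mem_thickening_of_mem_limitSet h𝕋 (hKU (htK x hx)) (half_pos hη)
  filter_upwards [h] with T hT x hx
  obtain ⟨y, hy, hxy⟩ := mem_iUnion₂.1 (hcov hx)
  obtain ⟨u, hu, hyu⟩ := Metric.mem_thickening_iff.1 (hT y hy)
  exact ⟨u, hu, by linarith [dist_triangle x y u, Metric.mem_ball.1 hxy]⟩

/-- The points of `K` at distance at least `η` from `S` form a compact set disjoint from the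
decreasing intersection of closures, so a single one of these closures already misses it. -/
lemma eventually_forall_mem_inter_compact_exists_dist_lt {p : ℕ} {𝕋 : Set ℝ} (h𝕋 : ¬ BddAbove 𝕋)
    {UT : 𝕋 → Set (Vec p)} {S K : Set (Vec p)} (hS : outerLimitSet UT ⊆ S) (hK : IsCompact K)
    {η : ℝ} (hη : 0 < η) :
    ∀ᶠ T in atTop, ∀ u ∈ UT T, u ∈ K → ∃ x ∈ S, dist u x < η := by
  have hK' : IsCompact (K \ Metric.thickening η S) := hK.diff Metric.isOpen_thickening
  have hempty : (K \ Metric.thickening η S) ∩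
      ⋂ N : ℕ, closure (⋃ (T : 𝕋) (_ : (N : ℝ) ≤ T), UT T) = ∅ := by
    rw [eq_empty_iff_forall_notMem]
    rintro x ⟨⟨-, hx⟩, hx'⟩
    exact hx (Metric.self_subset_thickening hη S (hS hx'))
  obtain ⟨N, hN⟩ := hK'.elim_directed_family_closed
    (fun N : ℕ => closure (⋃ (T : 𝕋) (_ : (N : ℝ) ≤ T), UT T)) (fun _ => isClosed_closure) hempty
    (by
      refine Antitone.directed_ge fun m n hmn => closure_mono (iUnion_mono fun T => ?_)
      exact iUnion_mono' fun h => ⟨(Nat.cast_le.2 hmn).trans h, le_rfl⟩)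
  filter_upwards [(tendsto_coe_atTop_of_not_bddAbove h𝕋).eventually_ge_atTop (N : ℝ)]
    with T hT u hu huK
  by_contra hcon
  have hmem : u ∈ (K \ Metric.thickening η S) ∩ closure (⋃ (T : 𝕋) (_ : (N : ℝ) ≤ T), UT T) :=
    ⟨⟨huK, fun h => hcon (Metric.mem_thickening_iff.1 h)⟩,
      subset_closure (mem_iUnion₂.2 ⟨T, hT, hu⟩)⟩
  rw [hN] at hmem
  exact hmem

/-! ### Taylor expansion up to the boundary of the smoothness domain. -/

/-- First order Taylor estimate on a segment for a function of one real variable. -/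
lemma abs_sub_sub_mul_le_of_hasDerivAt {f f' f'' : ℝ → ℝ} {s t C : ℝ} (hst : s ≤ t)
    (hf : ∀ x ∈ Icc s t, HasDerivAt f (f' x) x) (hf' : ∀ x ∈ Icc s t, HasDerivAt f' (f'' x) x)
    (hC : ∀ x ∈ Icc s t, |f'' x| ≤ C) :
    |f t - f s - f' s * (t - s)| ≤ C / 2 * (t - s) ^ 2 := by
  have h1 : ∀ x ∈ Icc s t, |f' x - f' s| ≤ C * (x - s) := by
    intro x hx
    refine image_norm_le_of_norm_deriv_right_le_deriv_boundary' (f := fun x => f' x - f' s)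
      (f' := f'') (B := fun x => C * (x - s)) (B' := fun _ => C) (a := s) (b := t)
      (fun x hx => ((hf' x hx).sub_const _).continuousAt.continuousWithinAt)
      (fun x hx => ((hf' x (Ico_subset_Icc_self hx)).sub_const _).hasDerivWithinAt) (by simp)
      (by fun_prop) (fun x _ => ?_) (fun x hx => hC x (Ico_subset_Icc_self hx)) hx
    simpa using (((hasDerivAt_id x).sub_const s).const_mul C).hasDerivWithinAt
  have hd : ∀ x ∈ Icc s t, HasDerivAt (fun x => f x - f s - f' s * (x - s)) (f' x - f' s) x := by
    intro x hx
    exact (((hf x hx).sub_const (f s)).fun_sub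
      (((hasDerivAt_id x).sub_const s).const_mul (f' s))).congr_deriv (by simp)
  refine image_norm_le_of_norm_deriv_right_le_deriv_boundary'
    (f := fun x => f x - f s - f' s * (x - s)) (f' := fun x => f' x - f' s)
    (B := fun x => C / 2 * (x - s) ^ 2) (B' := fun x => C * (x - s)) (a := s) (b := t)
    (fun x hx => (hd x hx).continuousAt.continuousWithinAt)
    (fun x hx => (hd x (Ico_subset_Icc_self hx)).hasDerivWithinAt) (by simp)
    (by fun_prop) (fun x _ => ?_) (fun x hx => h1 x (Ico_subset_Icc_self hx))
    (right_mem_Icc.2 hst)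
  exact (((((hasDerivAt_id x).sub_const s).fun_pow 2).const_mul (C / 2)).congr_deriv
    (by simp; ring)).hasDerivWithinAt

lemma extendFrom_eq_self_of_isOpen {X Z : Type*} [TopologicalSpace X] [TopologicalSpace Z]
    [T1Space Z] {N : Set X} {f : X → Z} {x : X} (hN : IsOpen N) (hx : x ∈ N)
    (hf : ∃ y, Tendsto f (𝓝[N] x) (𝓝 y)) : extendFrom N f x = f x := by
  have h := tendsto_extendFrom hf
  rw [hN.nhdsWithin_eq hx] at h
  exact (eq_of_tendsto_nhds h).symm

lemma fderiv_fderiv_apply_eq_inner_hessian {p : ℕ} (f : Vec p → ℝ) (x w : Vec p) :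
    fderiv ℝ (fderiv ℝ f) x w w = inner ℝ w (Matrix.toEuclideanLin (hessian f x) w) := by
  have hw : w = ∑ i, w i • EuclideanSpace.single i (1 : ℝ) := by
    ext j
    simp [Pi.single_apply]
  have hL : ∀ L : Vec p →L[ℝ] ℝ, L w = ∑ i, w i * L (EuclideanSpace.single i 1) := by
    intro L
    conv_lhs => rw [hw]
    simp
  have hB : fderiv ℝ (fderiv ℝ f) x w =
      ∑ i, w i • fderiv ℝ (fderiv ℝ f) x (EuclideanSpace.single i 1) := by
    conv_lhs => rw [hw]
    simp
  rw [hB]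
  simp only [sum_apply, smul_apply, smul_eq_mul]
  simp only [PiLp.inner_apply, Matrix.toLpLin_apply, Matrix.mulVec, dotProduct, hessian,
    Matrix.of_apply]
  refine Finset.sum_congr rfl fun i _ => ?_
  rw [hL]
  simp [mul_comm]

/-- Since `θs` may lie on the boundary, where only the extended derivatives make sense, Taylor's
formula is applied on the part `[s, 1]` of the segment, which lies in `N`, and then `s ↓ 0`. -/
lemma abs_sub_sub_logQuad_le_of_mem {p : ℕ} {N : Set (Vec p)} (hN : IsOpen N) {θs : Vec p}
    (hstar : ∀ θ ∈ N, ∀ t : ℝ, 0 < t → t ≤ 1 → t • θ + (1 - t) • θs ∈ N) (hθs : θs ∈ closure N)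
    {h : Vec p → ℝ} (hh : IsC2OnClosure N h) {A G : Mat p} {δ r : ℝ}
    (hr : ∀ θ ∈ closure N, ‖θ - θs‖ < δ → frobNorm (Aᵀ * hessExt N h θ * A + G) ≤ r) {u : Vec p}
    (hu : θs + Matrix.toEuclideanLin A u ∈ N) (hδ : ‖Matrix.toEuclideanLin A u‖ < δ) :
    |h (θs + Matrix.toEuclideanLin A u) - h θs - logQuad (scaledScore N A h θs) G u|
      ≤ r / 2 * ‖u‖ ^ 2 := by
  set w := Matrix.toEuclideanLin A u with hw
  set c : ℝ := inner ℝ u (Matrix.toEuclideanLin G u) with hc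
  set γ : ℝ → Vec p := fun t => θs + t • w with hγ
  have hγN : ∀ t, 0 < t → t ≤ 1 → γ t ∈ N := by
    intro t h0 h1
    have := hstar _ hu t h0 h1
    convert this using 1
    simp only [hγ, smul_add, sub_smul, one_smul]
    abel
  have hγd : ∀ t, HasDerivAt γ w t := fun t => by
    exact (((hasDerivAt_id t).smul_const w).const_add θs).congr_deriv (one_smul ℝ w)
  have hdiff : ∀ x ∈ N, ContDiffAt ℝ 2 h x := fun x hx =>
    hh.contDiffOn.contDiffAt (hN.mem_nhds hx)
  -- Adding `c / 2 * t ^ 2` makes the second derivative along the segment the form `Aᵀ h'' A + G` at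
  -- `u`, which `hr` bounds by `r * ‖u‖ ^ 2`.
  have hd1 : ∀ t, 0 < t → t ≤ 1 → HasDerivAt (fun t => h (γ t) + c / 2 * t ^ 2)
      (fderiv ℝ h (γ t) w + c * t) t := by
    intro t h0 h1
    have hx := (hdiff _ (hγN t h0 h1)).differentiableAt (by norm_num)
    refine (hx.hasFDerivAt.comp_hasDerivAt t (hγd t)).fun_add ?_
    exact ((hasDerivAt_pow 2 t).const_mul (c / 2)).congr_deriv (by simp; ring)
  have hd2 : ∀ t, 0 < t → t ≤ 1 → HasDerivAt (fun t => fderiv ℝ h (γ t) w + c * t)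
      (fderiv ℝ (fderiv ℝ h) (γ t) w w + c) t := by
    intro t h0 h1
    have hx := ((hdiff _ (hγN t h0 h1)).fderiv_right (m := 1) (by norm_num)).differentiableAt
      (by norm_num)
    have h2 := (hx.hasFDerivAt.comp_hasDerivAt t (hγd t)).clm_apply (hasDerivAt_const t w)
    refine (h2.congr_deriv (by simp)).fun_add ?_
    simpa using (hasDerivAt_id t).const_mul c
  have hbound : ∀ t, 0 < t → t ≤ 1 →
      |fderiv ℝ (fderiv ℝ h) (γ t) w w + c| ≤ r * ‖u‖ ^ 2 := by
    intro t h0 h1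
    have hx := hγN t h0 h1
    have hnorm : ‖γ t - θs‖ < δ := by
      simp only [hγ, add_sub_cancel_left, norm_smul, Real.norm_eq_abs, abs_of_pos h0]
      nlinarith [norm_nonneg w]
    have h3 := hr _ (subset_closure hx) hnorm
    have h4 : hessExt N h (γ t) = hessian h (γ t) :=
      extendFrom_eq_self_of_isOpen hN hx (hh.hessian_extends _ (subset_closure hx))
    rw [h4] at h3
    have h5 := abs_inner_toEuclideanLin_le (Aᵀ * hessian h (γ t) * A + G) u u
    rw [map_add, LinearMap.add_apply, inner_add_right, inner_conj_toEuclideanLin, ← hw, ← hc,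
      ← fderiv_fderiv_apply_eq_inner_hessian] at h5
    refine h5.trans ?_
    rw [mul_assoc, ← sq]
    gcongr
  have hT : ∀ s ∈ Ioc (0 : ℝ) 1, |(h (γ 1) + c / 2 * 1 ^ 2) - (h (γ s) + c / 2 * s ^ 2)
      - (fderiv ℝ h (γ s) w + c * s) * (1 - s)| ≤ r * ‖u‖ ^ 2 / 2 * (1 - s) ^ 2 := fun s hs =>
    abs_sub_sub_mul_le_of_hasDerivAt (f := fun t => h (γ t) + c / 2 * t ^ 2)
      (f' := fun t => fderiv ℝ h (γ t) w + c * t)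
      (f'' := fun t => fderiv ℝ (fderiv ℝ h) (γ t) w w + c) hs.2
      (fun x hx => hd1 x (hs.1.trans_le hx.1) hx.2) (fun x hx => hd2 x (hs.1.trans_le hx.1) hx.2)
      (fun x hx => hbound x (hs.1.trans_le hx.1) hx.2)
  have hev : ∀ᶠ s in 𝓝[>] (0 : ℝ), s ∈ Ioc (0 : ℝ) 1 := Ioc_mem_nhdsGT one_pos
  have hγ0 : Tendsto γ (𝓝[>] 0) (𝓝[N] θs) := by
    refine tendsto_nhdsWithin_iff.2 ⟨?_, hev.mono fun s hs => hγN s hs.1 hs.2⟩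
    have : Tendsto γ (𝓝 0) (𝓝 (γ 0)) := (hγd 0).continuousAt
    simpa [hγ] using this.mono_left nhdsWithin_le_nhds
  have hid : Tendsto (fun s : ℝ => s) (𝓝[>] 0) (𝓝 0) := nhdsWithin_le_nhds
  have l1 : Tendsto (fun s => h (γ s)) (𝓝[>] 0) (𝓝 (h θs)) :=
    ((hh.continuousOn θs hθs).mono subset_closure).tendsto.comp hγ0
  have l2 : Tendsto (fun s => fderiv ℝ h (γ s) w) (𝓝[>] 0) (𝓝 (inner ℝ (gradExt N h θs) w)) := by
    have h1 : Tendsto (fun s => gradient h (γ s)) (𝓝[>] 0) (𝓝 (gradExt N h θs)) :=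
      (tendsto_extendFrom (hh.gradient_extends θs hθs)).comp hγ0
    simpa only [inner_gradient_left] using h1.inner (𝕜 := ℝ) (tendsto_const_nhds (x := w))
  have hlim := le_of_tendsto_of_tendsto
    (((tendsto_const_nhds (x := h (γ 1) + c / 2 * 1 ^ 2)).sub
      (l1.add ((hid.pow 2).const_mul (c / 2)))).sub
        ((l2.add (hid.const_mul c)).mul ((tendsto_const_nhds (x := (1 : ℝ))).sub hid))).abs
    (((tendsto_const_nhds (x := (1 : ℝ))).sub hid).pow 2 |>.const_mul (r * ‖u‖ ^ 2 / 2))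
    (hev.mono fun s hs => hT s hs)
  have hq : logQuad (scaledScore N A h θs) G u = inner ℝ (gradExt N h θs) w - 1 / 2 * c := by
    rw [logQuad, scaledScore, inner_toEuclideanLin_transpose]
  have hγ1 : γ 1 = θs + w := by simp [hγ]
  rw [hq, ← hγ1]
  refine (le_of_eq_of_le ?_ hlim).trans_eq ?_
  · congr 1; ring
  · ring

/-- Second order Taylor expansion at a point of the closure of a star-shaped open set. -/
lemma abs_sub_sub_logQuad_le {p : ℕ} {N : Set (Vec p)} (hN : IsOpen N) {θs : Vec p}
    (hstar : ∀ θ ∈ N, ∀ t : ℝ, 0 < t → t ≤ 1 → t • θ + (1 - t) • θs ∈ N) (hθs : θs ∈ closure N)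
    {h : Vec p → ℝ} (hh : IsC2OnClosure N h) {A G : Mat p} (hA : IsUnit A.det) {δ r : ℝ}
    (hr : ∀ θ ∈ closure N, ‖θ - θs‖ < δ → frobNorm (Aᵀ * hessExt N h θ * A + G) ≤ r) {u : Vec p}
    (hu : θs + Matrix.toEuclideanLin A u ∈ closure N) (hδ : ‖Matrix.toEuclideanLin A u‖ < δ) :
    |h (θs + Matrix.toEuclideanLin A u) - h θs - logQuad (scaledScore N A h θs) G u|
      ≤ r / 2 * ‖u‖ ^ 2 := by
  set θ := θs + Matrix.toEuclideanLin A u with hθ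
  set v : Vec p → Vec p := fun x => Matrix.toEuclideanLin A⁻¹ (x - θs) with hv
  have hAv : ∀ x, θs + Matrix.toEuclideanLin A (v x) = x := fun x => by
    simp [hv, toEuclideanLin_mul_inv_cancel hA]
  have hvθ : v θ = u := by simp [hv, hθ, toEuclideanLin_inv_mul_cancel hA]
  have hvc : Continuous v := by
    have : Continuous (Matrix.toEuclideanLin A⁻¹) := LinearMap.continuous_of_finiteDimensional _
    fun_prop
  have hvt : Tendsto v (𝓝[N] θ) (𝓝 u) := by
    have := (hvc.tendsto θ).mono_left (nhdsWithin_le_nhds (s := N))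
    rwa [hvθ] at this
  have hq : Continuous fun x => logQuad (scaledScore N A h θs) G x :=
    continuous_logQuad.comp (by fun_prop : Continuous fun x : Vec p =>
      ((scaledScore N A h θs, G), x))
  have : (𝓝[N] θ).NeBot := mem_closure_iff_nhdsWithin_neBot.1 hu
  -- Both sides are continuous within `N` up to `θ`, so the estimate at interior points passes to
  -- the closure.
  refine le_of_tendsto_of_tendsto
    (((((hh.continuousOn θ hu).mono subset_closure).tendsto.sub_const (h θs)).sub
      ((hq.tendsto u).comp hvt)).abs) ((hvt.norm.pow 2).const_mul (r / 2)) ?_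
  have hnear : ∀ᶠ x in 𝓝[N] θ, ‖x - θs‖ < δ := by
    have : Tendsto (fun x => ‖x - θs‖) (𝓝[N] θ) (𝓝 ‖θ - θs‖) :=
      (by fun_prop : Continuous fun x : Vec p => ‖x - θs‖).continuousWithinAt
    exact this.eventually_lt_const (by simpa [hθ] using hδ)
  filter_upwards [self_mem_nhdsWithin, hnear] with x hx hxδ
  have hx' : Matrix.toEuclideanLin A (v x) = x - θs := by
    rw [eq_sub_iff_add_eq, add_comm]; exact hAv x
  have := abs_sub_sub_logQuad_le_of_mem hN hstar hθs hh hr (u := v x) (by rwa [hAv])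
    (by rwa [hx'])
  rwa [hAv] at this

/-! ### Measurability of the score. -/

lemma measurable_gradient_apply_of_mem {p : ℕ} {Ω : Type*} [MeasurableSpace Ω] {N : Set (Vec p)}
    (hN : IsOpen N) {h : Ω → Vec p → ℝ} (hmeas : ∀ θ ∈ N, Measurable fun ω => h ω θ)
    (hdiff : ∀ ω, ContDiffOn ℝ 2 (h ω) N) {x : Vec p} (hx : x ∈ N) :
    Measurable fun ω => gradient (h ω) x := by
  have hcoord : ∀ v : Vec p, Measurable fun ω => fderiv ℝ (h ω) x v := by
    intro v
    have hc : Tendsto (fun n : ℕ => (n : ℝ)⁻¹) atTop (𝓝 0) := tendsto_inv_atTop_nhds_zero_nat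
    have hxn : Tendsto (fun n : ℕ => x + (n : ℝ)⁻¹ • v) atTop (𝓝 x) := by
      simpa using (hc.smul_const v).const_add x
    obtain ⟨n₀, hn₀⟩ := eventually_atTop.1 (hxn.eventually (hN.mem_nhds hx))
    -- Directional derivatives are limits of difference quotients; the shift by `n₀` keeps the
    -- evaluation points in `N`, where measurability is known.
    refine measurable_of_tendsto_metrizable
      (f := fun (n : ℕ) ω => ((n + n₀ : ℕ) : ℝ) • (h ω (x + ((n + n₀ : ℕ) : ℝ)⁻¹ • v) - h ω x))
      (fun n => ?_) ?_
    · simp only [smul_eq_mul]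
      exact ((hmeas _ (hn₀ (n + n₀) (by omega))).sub (hmeas _ hx)).const_mul _
    · refine tendsto_pi_nhds.2 fun ω => ?_
      have hd := ((hdiff ω).contDiffAt (hN.mem_nhds hx)).differentiableAt (by norm_num)
      refine (hd.hasFDerivAt.lim v (c := fun n : ℕ => (n : ℝ)) ?_).comp (tendsto_add_atTop_nat n₀)
      simpa using tendsto_natCast_atTop_atTop (R := ℝ)
  have hpi : Measurable fun ω => (gradient (h ω) x).ofLp := by
    refine measurable_pi_iff.2 fun i => ?_
    convert hcoord (EuclideanSpace.single i 1) using 2 with ω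
    rw [← inner_gradient_left, EuclideanSpace.inner_single_right]
    simp
  exact (WithLp.measurable_toLp 2 (Fin p → ℝ)).comp hpi

lemma measurable_scaledScore {p : ℕ} {Ω : Type*} [MeasurableSpace Ω] {N : Set (Vec p)}
    (hN : IsOpen N) {h : Ω → Vec p → ℝ} (hmeas : ∀ θ ∈ N, Measurable fun ω => h ω θ)
    (hh : ∀ ω, IsC2OnClosure N (h ω)) {θs : Vec p} (hθs : θs ∈ closure N) (A : Mat p) :
    Measurable fun ω => scaledScore N A (h ω) θs := by
  have hA : Measurable (Matrix.toEuclideanLin Aᵀ) :=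
    (LinearMap.continuous_of_finiteDimensional _).measurable
  refine hA.comp ?_
  -- One deterministic sequence in `N` serves for all `ω`, so the extended gradient is a limit of
  -- measurable functions.
  obtain ⟨x, hxN, hx⟩ := mem_closure_iff_seq_limit.1 hθs
  refine measurable_of_tendsto_metrizable (f := fun n ω => gradient (h ω) (x n))
    (fun n => measurable_gradient_apply_of_mem hN hmeas (fun ω => (hh ω).contDiffOn) (hxN n)) ?_
  refine tendsto_pi_nhds.2 fun ω => ?_
  exact (tendsto_extendFrom ((hh ω).gradient_extends θs hθs)).comp
    (tendsto_nhdsWithin_iff.2 ⟨hx, Eventually.of_forall hxN⟩)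

/-! ### Stable convergence jointly with `𝒢`-measurable variables. -/

section StableConvergence

variable {ι Ω S M : Type*} [TopologicalSpace S] [MeasurableSpace S] [BorelSpace S]
  [PseudoMetricSpace M] {𝒢 : MeasurableSpace Ω} [mΩ : MeasurableSpace Ω] {μ : Measure Ω}
  [IsFiniteMeasure μ] {Y : ι → Ω → S} {l : Filter ι} {Y₀ : Ω → S}

lemma integrable_mul_of_abs_le {f Z : Ω → ℝ} {B C : ℝ} (hf : Measurable f) (hB : ∀ ω, |f ω| ≤ B)
    (hZ : Measurable Z) (hC : ∀ ω, |Z ω| ≤ C) : Integrable (fun ω => f ω * Z ω) μ := by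
  refine Integrable.of_bound (hf.mul hZ).aestronglyMeasurable (B * C) (ae_of_all _ fun ω => ?_)
  rw [Real.norm_eq_abs, abs_mul]
  exact mul_le_mul (hB ω) (hC ω) (abs_nonneg _) ((abs_nonneg _).trans (hB ω))

/-- On each fibre of `G` the second argument is constant, and `Z` times the indicator of the fibre
is again an admissible multiplier. -/
lemma StableTendsto.tendsto_integral_simpleFunc (h𝒢 : 𝒢 ≤ mΩ) (hst : StableTendsto 𝒢 μ Y l Y₀)
    (hY : ∀ i, Measurable (Y i)) (hY₀ : Measurable Y₀) (G : @SimpleFunc Ω 𝒢 M) {φ : S × M → ℝ}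
    (hφ : Continuous φ) {B : ℝ} (hB : ∀ x, |φ x| ≤ B) {Z : Ω → ℝ} (hZ : Measurable[𝒢] Z) {C : ℝ}
    (hC : ∀ ω, |Z ω| ≤ C) :
    Tendsto (fun i => ∫ ω, φ (Y i ω, G ω) * Z ω ∂μ) l (𝓝 (∫ ω, φ (Y₀ ω, G ω) * Z ω ∂μ)) := by
  classical
  have hind : ∀ m, Measurable[𝒢] (indicator (G ⁻¹' {m}) Z) := fun m =>
    hZ.indicator (@SimpleFunc.measurableSet_fiber _ _ 𝒢 G m)
  have hindC : ∀ m ω, |indicator (G ⁻¹' {m}) Z ω| ≤ C := fun m ω => by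
    by_cases h : ω ∈ G ⁻¹' {m}
    · rw [indicator_of_mem h]; exact hC ω
    · rw [indicator_of_notMem h, abs_zero]; exact (abs_nonneg _).trans (hC ω)
  have hsum : ∀ y : Ω → S, Measurable y → ∫ ω, φ (y ω, G ω) * Z ω ∂μ =
      ∑ m ∈ @SimpleFunc.range _ _ 𝒢 G, ∫ ω, φ (y ω, m) * indicator (G ⁻¹' {m}) Z ω ∂μ := by
    intro y hy
    rw [← integral_finsetSum]
    · refine integral_congr_ae (ae_of_all _ fun ω => ?_)
      simp only
      rw [Finset.sum_eq_single_of_mem (G ω) (@SimpleFunc.mem_range_self _ _ 𝒢 G ω)]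
      · rw [indicator_of_mem (by simp)]
      · intro m _ hm
        rw [indicator_of_notMem (by simpa using hm.symm), mul_zero]
    · intro m _
      refine integrable_mul_of_abs_le (B := B) (C := C) ?_ (fun ω => hB _)
        ((hind m).mono h𝒢 le_rfl) (hindC m)
      exact (hφ.comp (by fun_prop : Continuous fun s : S => (s, m))).measurable.comp hy
  simp only [fun i => hsum (Y i) (hY i), hsum Y₀ hY₀]
  refine tendsto_finsetSum _ fun m _ => ?_
  have := hst (BoundedContinuousFunction.ofNormedAddCommGroup (fun s => φ (s, m)) (by fun_prop) B
    fun s => hB _) _ (hind m) ⟨C, hindC m⟩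
  simpa using this

/-- Stable convergence is joint with the conditioning variables. -/
theorem StableTendsto.tendsto_integral_prod [SecondCountableTopology S]
    [SecondCountableTopology M] [MeasurableSpace M] [BorelSpace M] (h𝒢 : 𝒢 ≤ mΩ) (hst : StableTendsto 𝒢 μ Y l Y₀)
    (hY : ∀ i, Measurable (Y i)) (hY₀ : Measurable Y₀) {G : Ω → M} (hG : Measurable[𝒢] G)
    {φ : S × M → ℝ} (hφ : Continuous φ) {B : ℝ} (hB : ∀ x, |φ x| ≤ B) {L : ℝ} (hL0 : 0 ≤ L)
    (hL : ∀ s m m', |φ (s, m) - φ (s, m')| ≤ L * dist m m') {Z : Ω → ℝ} (hZ : Measurable[𝒢] Z)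
    {C : ℝ} (hC : ∀ ω, |Z ω| ≤ C) :
    Tendsto (fun i => ∫ ω, φ (Y i ω, G ω) * Z ω ∂μ) l (𝓝 (∫ ω, φ (Y₀ ω, G ω) * Z ω ∂μ)) := by
  have hsm : StronglyMeasurable[𝒢] G := hG.stronglyMeasurable
  set Gn : ℕ → @SimpleFunc Ω 𝒢 M := fun n => hsm.approx n with hGn
  have hGm : Measurable G := hG.mono h𝒢 le_rfl
  have hGnm : ∀ n, Measurable (Gn n) := fun n =>
    (@SimpleFunc.measurable Ω M 𝒢 _ (Gn n)).mono h𝒢 le_rfl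
  have hZm : Measurable Z := hZ.mono h𝒢 le_rfl
  -- The cap `2 * B` allows dominated convergence without integrability of `G`.
  set e : ℕ → Ω → ℝ := fun n ω => min (L * dist (G ω) (Gn n ω)) (2 * B) * C with he
  have hem : ∀ n, Measurable (e n) := fun n =>
    (((hGm.dist (hGnm n)).const_mul L).min measurable_const).mul_const C
  have hbd : ∀ n ω, ‖e n ω‖ ≤ 2 * |B| * |C| := by
    intro n ω
    have hB0 : 0 ≤ B := (abs_nonneg _).trans (hB (Y₀ ω, G ω))
    have h0 : 0 ≤ min (L * dist (G ω) (Gn n ω)) (2 * B) :=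
      le_min (mul_nonneg hL0 dist_nonneg) (by linarith)
    simp only [he, norm_mul, Real.norm_eq_abs, abs_of_nonneg h0, abs_of_nonneg hB0]
    gcongr
    exact min_le_right _ _
  have hlim : Tendsto (fun n => ∫ ω, e n ω ∂μ) atTop (𝓝 0) := by
    have := tendsto_integral_of_dominated_convergence (μ := μ) (F := e) (f := fun _ => 0)
      (fun _ => 2 * |B| * |C|) (fun n => (hem n).aestronglyMeasurable) (integrable_const _)
      (fun n => ae_of_all _ (hbd n)) (ae_of_all _ fun ω => ?_)
    · simpa using this
    · have hB0 : 0 ≤ B := (abs_nonneg _).trans (hB (Y₀ ω, G ω))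
      have h1 : Tendsto (fun n => dist (G ω) (Gn n ω)) atTop (𝓝 0) := by
        have := tendsto_const_nhds (x := G ω) |>.dist (hsm.tendsto_approx ω)
        simpa using this
      have h2 := ((h1.const_mul L).min (tendsto_const_nhds (x := 2 * B))).mul_const C
      rw [mul_zero, min_eq_left (by linarith), zero_mul] at h2
      exact h2
  -- The bound is independent of `y`, so `n` can be fixed before the limit in `i` is taken.
  have herr : ∀ y : Ω → S, Measurable y → ∀ n,
      |∫ ω, φ (y ω, G ω) * Z ω ∂μ - ∫ ω, φ (y ω, Gn n ω) * Z ω ∂μ| ≤ ∫ ω, e n ω ∂μ := by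
    intro y hy n
    have i1 : Integrable (fun ω => φ (y ω, G ω) * Z ω) μ :=
      integrable_mul_of_abs_le (hφ.measurable.comp (hy.prodMk hGm)) (fun ω => hB _) hZm hC
    have i2 : Integrable (fun ω => φ (y ω, Gn n ω) * Z ω) μ :=
      integrable_mul_of_abs_le (hφ.measurable.comp (hy.prodMk (hGnm n))) (fun ω => hB _) hZm hC
    rw [← integral_sub i1 i2, ← Real.norm_eq_abs]
    refine norm_integral_le_of_norm_le
      (Integrable.of_bound (hem n).aestronglyMeasurable _ (ae_of_all _ (hbd n)))
      (ae_of_all _ fun ω => ?_)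
    rw [← sub_mul, Real.norm_eq_abs, abs_mul]
    have h1 := hB (y ω, G ω)
    have h2 := hB (y ω, Gn n ω)
    have h3 : |φ (y ω, G ω) - φ (y ω, Gn n ω)| ≤ min (L * dist (G ω) (Gn n ω)) (2 * B) :=
      le_min (hL _ _ _) ((abs_sub _ _).trans (by linarith))
    exact mul_le_mul h3 (hC ω) (abs_nonneg _) ((abs_nonneg _).trans h3)
  rw [Metric.tendsto_nhds]
  intro ε hε
  obtain ⟨n, hn⟩ := (hlim.eventually_lt_const (show (0 : ℝ) < ε / 3 by linarith)).exists
  have h1 := Metric.tendsto_nhds.1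
    (hst.tendsto_integral_simpleFunc h𝒢 hY hY₀ (Gn n) hφ hB hZ hC) (ε / 3) (by linarith)
  filter_upwards [h1] with i hi
  have h2 := herr (Y i) (hY i) n
  have h3 := herr Y₀ hY₀ n
  rw [Real.dist_eq] at hi ⊢
  rw [abs_lt] at hi ⊢
  rw [abs_le] at h2 h3
  constructor <;> linarith

end StableConvergence

/-! ### Elementary bounds for integrals, tails and suprema. -/

lemma integral_mul_le_of_measure_le {Ω : Type*} [MeasurableSpace Ω] {μ : Measure Ω}
    [IsProbabilityMeasure μ] {f Z : Ω → ℝ} {b c C κ : ℝ} (hf : Measurable f)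
    (hb : ∀ ω, |f ω| ≤ b) (hZ : Measurable Z) (hZ0 : ∀ ω, 0 ≤ Z ω) (hC : ∀ ω, Z ω ≤ C)
    (hb0 : 0 ≤ b) (hc0 : 0 ≤ c) (hC0 : 0 ≤ C) (hκ0 : 0 ≤ κ)
    (hκ : μ {ω | c < f ω} ≤ ENNReal.ofReal κ) :
    ∫ ω, f ω * Z ω ∂μ ≤ c * C + b * C * κ := by
  have hs : MeasurableSet {ω | c < f ω} := measurableSet_lt measurable_const hf
  have hle : ∀ ω, f ω * Z ω ≤ c * C + indicator {ω | c < f ω} (fun _ => b * C) ω := by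
    intro ω
    by_cases h : c < f ω
    · rw [indicator_of_mem (by exact h)]
      have h1 : f ω * Z ω ≤ b * C := mul_le_mul ((le_abs_self _).trans (hb ω)) (hC ω) (hZ0 ω) hb0
      nlinarith [mul_nonneg hc0 hC0]
    · rw [indicator_of_notMem (by exact h), add_zero]
      exact mul_le_mul (not_lt.1 h) (hC ω) (hZ0 ω) hc0
  have hint : Integrable (indicator {ω | c < f ω} fun _ => b * C) μ :=
    (integrable_const _).indicator hs
  calc ∫ ω, f ω * Z ω ∂μ
      ≤ ∫ ω, (c * C + indicator {ω | c < f ω} (fun _ => b * C) ω) ∂μ :=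
        integral_mono (integrable_mul_of_abs_le hf hb hZ
          (fun ω => (abs_of_nonneg (hZ0 ω)).trans_le (hC ω))) ((integrable_const _).add hint) hle
    _ = c * C + μ.real {ω | c < f ω} * (b * C) := by
        rw [integral_add (integrable_const _) hint, integral_indicator_const _ hs]
        simp
    _ ≤ c * C + b * C * κ := by
        have h1 : μ.real {ω | c < f ω} ≤ κ := ENNReal.toReal_le_of_le_ofReal hκ0 hκ
        have h2 : 0 ≤ b * C := by positivity
        nlinarith

lemma exists_forall_measure_norm_gt_le {Ω E : Type*} [MeasurableSpace Ω] {μ : Measure Ω}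
    [IsFiniteMeasure μ] [NormedAddCommGroup E] [MeasurableSpace E] [BorelSpace E]
    {f : Ω → E} (hf : Measurable f) {ε : ℝ≥0∞} (hε : 0 < ε) :
    ∃ R₀ : ℝ, ∀ R ≥ R₀, μ {ω | R < ‖f ω‖} ≤ ε := by
  have h := tendsto_measure_iInter_atTop (μ := μ) (s := fun R : ℝ => {ω | R < ‖f ω‖})
    (fun R => (measurableSet_lt measurable_const hf.norm).nullMeasurableSet)
    (fun R R' hR ω hω => lt_of_le_of_lt hR hω) ⟨0, measure_ne_top _ _⟩
  have hempty : ⋂ R : ℝ, {ω | R < ‖f ω‖} = ∅ := by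
    rw [eq_empty_iff_forall_notMem]
    intro ω hω
    exact lt_irrefl ‖f ω‖ (mem_iInter.1 hω ‖f ω‖)
  rw [hempty, measure_empty] at h
  exact eventually_atTop.1 (h.eventually_le_const hε)

lemma abs_sSup_image_sub_le {X : Type*} [TopologicalSpace X] {K : Set X} (hK : IsCompact K)
    (hne : K.Nonempty) {f f' : X → ℝ} (hf : ContinuousOn f K) (hf' : ContinuousOn f' K) {e : ℝ}
    (h : ∀ x ∈ K, |f x - f' x| ≤ e) : |sSup (f '' K) - sSup (f' '' K)| ≤ e := by
  have key : ∀ {g g' : X → ℝ}, ContinuousOn g' K → (∀ x ∈ K, |g x - g' x| ≤ e) →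
      sSup (g '' K) ≤ sSup (g' '' K) + e := by
    intro g g' hg' hgg'
    refine csSup_le (hne.image g) ?_
    rintro _ ⟨x, hx, rfl⟩
    have h1 := le_csSup (hK.bddAbove_image hg') (mem_image_of_mem g' hx)
    linarith [(abs_le.1 (hgg' x hx)).2]
  have h1 := key hf' h
  have h2 := key (g := f') hf fun x hx => by rw [abs_sub_comm]; exact h x hx
  rw [abs_le]
  constructor <;> linarith

/-! ### The penalized supremum as a continuous functional of score and matrix. -/

/-- The supremum of `g` over pairs of points of `C`, penalized by the distance of
`logQuad D G` at these points from its maximum over `C`. -/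
noncomputable def penalizedSup {p : ℕ} (C : Set (Vec p)) (g : Vec p × Vec p → ℝ) (K : ℝ)
    (x : Vec p × Mat p) : ℝ :=
  sSup ((fun z : Vec p × Vec p => g z + K * (logQuad x.1 x.2 z.1 + logQuad x.1 x.2 z.2)) ''
    (C ×ˢ C)) - 2 * K * sSup (logQuad x.1 x.2 '' C)

section PenalizedSup

variable {p : ℕ} {C : Set (Vec p)} {g : Vec p × Vec p → ℝ}

lemma continuous_logQuad_pair (hg : Continuous g) (K : ℝ) :
    Continuous fun y : (Vec p × Mat p) × Vec p × Vec p =>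
      g y.2 + K * (logQuad y.1.1 y.1.2 y.2.1 + logQuad y.1.1 y.1.2 y.2.2) := by
  have h1 : Continuous fun y : (Vec p × Mat p) × Vec p × Vec p => logQuad y.1.1 y.1.2 y.2.1 :=
    continuous_logQuad.comp (by fun_prop : Continuous fun y : (Vec p × Mat p) × Vec p × Vec p =>
      (y.1, y.2.1))
  have h2 : Continuous fun y : (Vec p × Mat p) × Vec p × Vec p => logQuad y.1.1 y.1.2 y.2.2 :=
    continuous_logQuad.comp (by fun_prop : Continuous fun y : (Vec p × Mat p) × Vec p × Vec p =>
      (y.1, y.2.2))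
  fun_prop

lemma continuous_logQuad_pair_right (hg : Continuous g) (K : ℝ) (x : Vec p × Mat p) :
    Continuous fun z : Vec p × Vec p =>
      g z + K * (logQuad x.1 x.2 z.1 + logQuad x.1 x.2 z.2) :=
  (continuous_logQuad_pair hg K).comp (by fun_prop : Continuous fun z : Vec p × Vec p => (x, z))

lemma continuous_logQuad_right (D : Vec p) (G : Mat p) : Continuous (logQuad D G) :=
  continuous_logQuad.comp (by fun_prop : Continuous fun u : Vec p => ((D, G), u))

lemma continuous_penalizedSup (hC : IsCompact C) (hg : Continuous g) (K : ℝ) :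
    Continuous (penalizedSup C g K) := by
  have h1 : Continuous fun x : Vec p × Mat p =>
      sSup ((fun z : Vec p × Vec p => g z + K * (logQuad x.1 x.2 z.1 + logQuad x.1 x.2 z.2)) ''
        (C ×ˢ C)) :=
    IsCompact.continuous_sSup (f := fun (x : Vec p × Mat p) (z : Vec p × Vec p) =>
      g z + K * (logQuad x.1 x.2 z.1 + logQuad x.1 x.2 z.2)) (hC.prod hC)
      (continuous_logQuad_pair hg K)
  have h2 : Continuous fun x : Vec p × Mat p => sSup (logQuad x.1 x.2 '' C) :=
    IsCompact.continuous_sSup (f := fun (x : Vec p × Mat p) (u : Vec p) => logQuad x.1 x.2 u) hC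
      continuous_logQuad
  exact h1.sub (continuous_const.mul h2)

/-- Each `η`-maximal coordinate costs at most `K * η` in penalty. This is how the functional
controls `g` at near-maximizers without any measurable selection. -/
lemma sub_le_penalizedSup (hC : IsCompact C) (hg : Continuous g) {K : ℝ} (hK : 0 ≤ K)
    {x : Vec p × Mat p} {z : Vec p × Vec p} (hz : z ∈ C ×ˢ C) {η : ℝ}
    (h1 : ∀ u ∈ C, logQuad x.1 x.2 u ≤ logQuad x.1 x.2 z.1 + η)
    (h2 : ∀ u ∈ C, logQuad x.1 x.2 u ≤ logQuad x.1 x.2 z.2 + η) :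
    g z - 2 * K * η ≤ penalizedSup C g K x := by
  have h3 := le_csSup ((hC.prod hC).bddAbove_image
    (continuous_logQuad_pair_right hg K x).continuousOn) (mem_image_of_mem _ hz)
  have hne : (logQuad x.1 x.2 '' C).Nonempty := ⟨_, mem_image_of_mem _ hz.1⟩
  have h4 : sSup (logQuad x.1 x.2 '' C) ≤ logQuad x.1 x.2 z.1 + η :=
    csSup_le hne (by rintro _ ⟨u, hu, rfl⟩; exact h1 u hu)
  have h5 : sSup (logQuad x.1 x.2 '' C) ≤ logQuad x.1 x.2 z.2 + η :=
    csSup_le hne (by rintro _ ⟨u, hu, rfl⟩; exact h2 u hu)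
  unfold penalizedSup
  nlinarith [mul_le_mul_of_nonneg_left h4 hK, mul_le_mul_of_nonneg_left h5 hK]

lemma penalizedSup_le (hne : C.Nonempty) {K : ℝ} {x : Vec p × Mat p} {b : ℝ}
    (h : ∀ z ∈ C ×ˢ C, g z + K * (logQuad x.1 x.2 z.1 + logQuad x.1 x.2 z.2)
      - 2 * K * sSup (logQuad x.1 x.2 '' C) ≤ b) : penalizedSup C g K x ≤ b := by
  unfold penalizedSup
  rw [sub_le_iff_le_add]
  refine csSup_le ((hne.prod hne).image _) ?_
  rintro _ ⟨z, hz, rfl⟩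
  linarith [h z hz]

lemma abs_penalizedSup_le (hC : IsCompact C) (hne : C.Nonempty) (hg : Continuous g) {B : ℝ}
    (hB : ∀ z, |g z| ≤ B) {K : ℝ} (hK : 0 ≤ K) (x : Vec p × Mat p) :
    |penalizedSup C g K x| ≤ B := by
  have hq : ContinuousOn (logQuad x.1 x.2) C := (continuous_logQuad_right _ _).continuousOn
  obtain ⟨w, hw, hmax⟩ := hC.exists_isMaxOn hne hq
  rw [abs_le]
  constructor
  · have := sub_le_penalizedSup hC hg hK (x := x) (z := (w, w)) ⟨hw, hw⟩ (η := 0)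
      (fun u hu => by simpa using hmax hu) (fun u hu => by simpa using hmax hu)
    linarith [(abs_le.1 (hB (w, w))).1]
  · refine penalizedSup_le hne fun z hz => ?_
    have h1 := le_csSup (hC.bddAbove_image hq) (mem_image_of_mem _ hz.1)
    have h2 := le_csSup (hC.bddAbove_image hq) (mem_image_of_mem _ hz.2)
    nlinarith [(abs_le.1 (hB z)).2, mul_le_mul_of_nonneg_left h1 hK,
      mul_le_mul_of_nonneg_left h2 hK]

/-- The Lipschitz constant in the matrix does not depend on the score `D`, as the joint stable
convergence requires. -/
lemma abs_penalizedSup_sub_le (hC : IsCompact C) (hne : C.Nonempty) (hg : Continuous g) {R : ℝ}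
    (hR : ∀ u ∈ C, ‖u‖ ≤ R) {K : ℝ} (hK : 0 ≤ K) (D : Vec p) (G G' : Mat p) :
    |penalizedSup C g K (D, G) - penalizedSup C g K (D, G')| ≤
      2 * K * R ^ 2 * frobNorm (G - G') := by
  have hq : ∀ u ∈ C, |logQuad D G u - logQuad D G' u| ≤ 1 / 2 * R ^ 2 * frobNorm (G - G') := by
    intro u hu
    refine (abs_logQuad_sub_le_of_matrix D G G' u).trans ?_
    have := mul_le_mul_of_nonneg_left (pow_le_pow_left₀ (norm_nonneg u) (hR u hu) 2)
      (frobNorm_nonneg (G - G'))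
    linarith
  have h1 := abs_sSup_image_sub_le hC hne (continuous_logQuad_right D G).continuousOn
    (continuous_logQuad_right D G').continuousOn hq
  have h2 := abs_sSup_image_sub_le (hC.prod hC) (hne.prod hne)
    (continuous_logQuad_pair_right hg K (D, G)).continuousOn
    (continuous_logQuad_pair_right hg K (D, G')).continuousOn
    (e := K * R ^ 2 * frobNorm (G - G')) (fun z hz => by
      have e1 := abs_le.1 (hq z.1 hz.1)
      have e2 := abs_le.1 (hq z.2 hz.2)
      simp only
      rw [abs_le]
      constructor <;>
      nlinarith [mul_le_mul_of_nonneg_left e1.1 hK, mul_le_mul_of_nonneg_left e1.2 hK,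
        mul_le_mul_of_nonneg_left e2.1 hK, mul_le_mul_of_nonneg_left e2.2 hK])
  unfold penalizedSup
  rw [abs_le] at h1 h2 ⊢
  simp only at h2 ⊢
  constructor <;>
  nlinarith [mul_le_mul_of_nonneg_left h1.1 hK, mul_le_mul_of_nonneg_left h1.2 hK]

/-- Pairs with `g` at least `g (w, w) + ε / 2` form a compact set avoiding `(w, w)`. Their penalty
is therefore bounded below by `n * m` with `m > 0`, which eventually outweighs the boundedness of
`g`. -/
lemma tendsto_penalizedSup (hC : IsCompact C) (hg : Continuous g) {x : Vec p × Mat p} {w : Vec p}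
    (hw : w ∈ C) (hmax : ∀ u ∈ C, u ≠ w → logQuad x.1 x.2 u < logQuad x.1 x.2 w) :
    Tendsto (fun n : ℕ => penalizedSup C g n x) atTop (𝓝 (g (w, w))) := by
  have hle : ∀ u ∈ C, logQuad x.1 x.2 u ≤ logQuad x.1 x.2 w := fun u hu => by
    rcases eq_or_ne u w with rfl | h
    · exact le_rfl
    · exact (hmax u hu h).le
  have hlow : ∀ n : ℕ, g (w, w) ≤ penalizedSup C g n x := fun n => by
    simpa using sub_le_penalizedSup hC hg (Nat.cast_nonneg n) (x := x) (z := (w, w)) ⟨hw, hw⟩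
      (η := 0) (by simpa using hle) (by simpa using hle)
  have hsup : sSup (logQuad x.1 x.2 '' C) = logQuad x.1 x.2 w :=
    IsGreatest.csSup_eq ⟨mem_image_of_mem _ hw, by rintro _ ⟨u, hu, rfl⟩; exact hle u hu⟩
  rw [Metric.tendsto_atTop]
  intro ε hε
  set A : Set (Vec p × Vec p) := (C ×ˢ C) ∩ {z | g (w, w) + ε / 2 ≤ g z} with hA
  have hAc : IsCompact A :=
    (hC.prod hC).inter_right (isClosed_le continuous_const hg)
  have hgc := hAc.bddAbove_image hg.continuousOn
  obtain ⟨B, hB⟩ := hgc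
  have hq : Continuous fun z : Vec p × Vec p => logQuad x.1 x.2 z.1 + logQuad x.1 x.2 z.2 :=
    ((continuous_logQuad_right x.1 x.2).comp continuous_fst).add
      ((continuous_logQuad_right x.1 x.2).comp continuous_snd)
  have hgap : ∃ m > 0, ∀ z ∈ A,
      logQuad x.1 x.2 z.1 + logQuad x.1 x.2 z.2 ≤ 2 * logQuad x.1 x.2 w - m := by
    rcases A.eq_empty_or_nonempty with h | h
    · exact ⟨1, one_pos, by simp [h]⟩
    · obtain ⟨z₀, hz₀, hz₀max⟩ := hAc.exists_isMaxOn h hq.continuousOn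
      refine ⟨2 * logQuad x.1 x.2 w - (logQuad x.1 x.2 z₀.1 + logQuad x.1 x.2 z₀.2), ?_,
        fun z hz => ?_⟩
      · have e1 := hle _ hz₀.1.1
        have e2 := hle _ hz₀.1.2
        by_cases h1 : z₀.1 = w
        · by_cases h2 : z₀.2 = w
          · have : z₀ = (w, w) := Prod.ext h1 h2
            have h3 : g (w, w) + ε / 2 ≤ g z₀ := hz₀.2
            rw [this] at h3
            linarith
          · linarith [hmax _ hz₀.1.2 h2]
        · linarith [hmax _ hz₀.1.1 h1]
      · have : logQuad x.1 x.2 z.1 + logQuad x.1 x.2 z.2 ≤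
          logQuad x.1 x.2 z₀.1 + logQuad x.1 x.2 z₀.2 := hz₀max hz
        linarith
  obtain ⟨m, hm, hgap⟩ := hgap
  obtain ⟨n₀, hn₀⟩ := exists_nat_ge ((B - g (w, w)) / m)
  refine ⟨n₀, fun n hn => ?_⟩
  have hnm : B - g (w, w) ≤ n * m := by
    rw [← div_le_iff₀ hm]
    exact hn₀.trans (Nat.cast_le.2 hn)
  have hup : penalizedSup C g n x ≤ g (w, w) + ε / 2 := by
    refine penalizedSup_le ⟨w, hw⟩ fun z hz => ?_
    rw [hsup]
    have hn0 : (0 : ℝ) ≤ n := Nat.cast_nonneg n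
    by_cases hzA : z ∈ A
    · have h1 := mul_le_mul_of_nonneg_left (hgap z hzA) hn0
      have h2 := hB (mem_image_of_mem g hzA)
      nlinarith
    · have h1 : g z < g (w, w) + ε / 2 := by
        by_contra h
        exact hzA ⟨hz, not_lt.1 h⟩
      nlinarith [mul_le_mul_of_nonneg_left (hle _ hz.1) hn0,
        mul_le_mul_of_nonneg_left (hle _ hz.2) hn0]
  rw [Real.dist_eq, abs_of_nonneg (by linarith [hlow n])]
  linarith

end PenalizedSup

/-- Converts the Lipschitz bound to the sup distance on arrays; the factor `p` is the square root of
the number of entries. -/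
lemma frobNorm_of_sub_of_le_dist {p : ℕ} (m m' : Fin p → Fin p → ℝ) :
    frobNorm (Matrix.of m - Matrix.of m') ≤ p * dist m m' := by
  refine le_of_sq_le_sq ?_ (mul_nonneg p.cast_nonneg dist_nonneg)
  rw [sq_frobNorm, mul_pow]
  have h : ∀ i j, (Matrix.of m - Matrix.of m') i j ^ 2 ≤ dist m m' ^ 2 := fun i j => by
    rw [← sq_abs ((Matrix.of m - Matrix.of m') i j)]
    refine pow_le_pow_left₀ (abs_nonneg _) ?_ 2
    rw [Matrix.sub_apply, Matrix.of_apply, Matrix.of_apply, ← Real.dist_eq]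
    exact (dist_le_pi_dist (m i) (m' i) j).trans (dist_le_pi_dist m m' i)
  refine (Finset.sum_le_sum fun i _ => Finset.sum_le_sum fun j _ => h i j).trans_eq ?_
  simp
  ring

lemma continuous_penalizedSup_of {p : ℕ} {C : Set (Vec p)} (hC : IsCompact C)
    {g : Vec p × Vec p → ℝ} (hg : Continuous g) (K : ℝ) :
    Continuous fun x : Vec p × (Fin p → Fin p → ℝ) =>
      penalizedSup C g K (x.1, Matrix.of x.2) :=
  (continuous_penalizedSup hC hg K).comp (continuous_fst.prodMk
    (continuous_matrix fun i j => by simp only [Matrix.of_apply]; fun_prop))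

lemma measurable_penalizedSup {Ω : Type*} [MeasurableSpace Ω] {p : ℕ} {C : Set (Vec p)}
    (hC : IsCompact C) {g : Vec p × Vec p → ℝ} (hg : Continuous g) (K : ℝ) {D : Ω → Vec p}
    (hD : Measurable D) {Γ : Ω → Mat p} (hΓ : Measurable fun ω i j => Γ ω i j) :
    Measurable fun ω => penalizedSup C g K (D ω, Γ ω) := by
  have h1 : Measurable fun ω => (D ω, fun i j => Γ ω i j) := hD.prodMk hΓ
  have h2 := (continuous_penalizedSup_of hC hg K).measurable.comp h1
  have h3 : (fun ω => penalizedSup C g K (D ω, Γ ω)) =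
      fun ω => penalizedSup C g K (D ω, Matrix.of fun i j => Γ ω i j) :=
    funext fun ω => congrArg (fun G => penalizedSup C g K (D ω, G)) rfl
  rw [h3]
  exact h2

/-! ### Passage to the limit for asymptotic maximizers. -/

/-- With probability close to one, `x i ω` is close to a point of the compact part
`U ∩ closedBall 0 R` at which the field with score `D i ω` is almost maximal over this part, for
every large `R`. -/
def IsAsympMaximizer {Ω ι : Type*} [MeasurableSpace Ω] {p : ℕ} (μ : Measure Ω) (l : Filter ι)
    (U : Set (Vec p)) (D : ι → Ω → Vec p) (Γ : Ω → Mat p) (x : ι → Ω → Vec p) : Prop :=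
  ∀ ε : ℝ, 0 < ε → ∃ R₀ : ℝ, ∀ R ≥ R₀, ∀ η > 0, ∀ᶠ i in l,
    μ {ω | ¬ ∃ z ∈ U ∩ Metric.closedBall 0 R, dist (x i ω) z ≤ η ∧
      ∀ u ∈ U ∩ Metric.closedBall 0 R, logQuad (D i ω) (Γ ω) u ≤ logQuad (D i ω) (Γ ω) z + η}
      ≤ ENNReal.ofReal ε

section ArgmaxConvergence

variable {Ω ι : Type*} {𝒢 : MeasurableSpace Ω} [mΩ : MeasurableSpace Ω] {p : ℕ} {μ : Measure Ω}
  [IsProbabilityMeasure μ] {l : Filter ι} {U : Set (Vec p)} {D : ι → Ω → Vec p} {Δ : Ω → Vec p}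
  {Γ : Ω → Mat p} {w : Ω → Vec p}

lemma exists_measure_penalizedSup_gt_le (hU : IsClosed U) (hΔm : Measurable Δ)
    (hΓ : Measurable fun ω i j => Γ ω i j) (hw : Measurable w) (hwU : ∀ ω, w ω ∈ U)
    (hmax : ∀ᵐ ω ∂μ, ∀ u ∈ U, u ≠ w ω → logQuad (Δ ω) (Γ ω) u < logQuad (Δ ω) (Γ ω) (w ω))
    {g : Vec p × Vec p → ℝ} (hg : Continuous g) {R κ c : ℝ} (hκ : 0 < κ) (hc : 0 < c)
    (hR : μ {ω | R < ‖w ω‖} ≤ ENNReal.ofReal κ) :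
    ∃ n : ℕ, μ {ω | c < penalizedSup (U ∩ Metric.closedBall 0 R) g n (Δ ω, Γ ω) - g (w ω, w ω)} ≤
      ENNReal.ofReal (2 * κ) := by
  set C := U ∩ Metric.closedBall (0 : Vec p) R with hCdef
  have hC : IsCompact C := (isCompact_closedBall 0 R).inter_left hU
  have hφm : ∀ n : ℕ, Measurable fun ω => penalizedSup C g n (Δ ω, Γ ω) := fun n =>
    measurable_penalizedSup hC hg n hΔm hΓ
  have hgm : Measurable fun ω => g (w ω, w ω) := hg.measurable.comp (hw.prodMk hw)
  have hs : MeasurableSet {ω | ‖w ω‖ ≤ R} := measurableSet_le hw.norm measurable_const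
  -- The restriction to `‖w ω‖ ≤ R` is needed because only then does `w ω` maximize over the
  -- truncated set `C`.
  set f : ℕ → Ω → ℝ := fun n => indicator {ω | ‖w ω‖ ≤ R}
    fun ω => penalizedSup C g n (Δ ω, Γ ω) - g (w ω, w ω) with hf
  have hlim : TendstoInMeasure μ f atTop fun _ => 0 := by
    refine tendstoInMeasure_of_tendsto_ae
      (fun n => (((hφm n).sub hgm).indicator hs).aestronglyMeasurable) ?_
    filter_upwards [hmax] with ω hω
    by_cases h : ‖w ω‖ ≤ R
    · simp only [hf, indicator_of_mem (show ω ∈ {ω | ‖w ω‖ ≤ R} from h)]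
      rw [← sub_self (g (w ω, w ω))]
      exact (tendsto_penalizedSup hC hg (x := (Δ ω, Γ ω)) ⟨hwU ω, by simpa using h⟩
        fun u hu => hω u hu.1).sub_const _
    · simp only [hf, indicator_of_notMem (show ω ∉ {ω | ‖w ω‖ ≤ R} from h)]
      exact tendsto_const_nhds
  have h1 := (hlim (ENNReal.ofReal c) (by simpa using hc)).eventually_le_const
    (show (0 : ℝ≥0∞) < ENNReal.ofReal κ by simpa using hκ)
  obtain ⟨n, hn⟩ := h1.exists
  refine ⟨n, ?_⟩
  have hsub : {ω | c < penalizedSup C g n (Δ ω, Γ ω) - g (w ω, w ω)} ⊆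
      {ω | ENNReal.ofReal c ≤ edist (f n ω) 0} ∪ {ω | R < ‖w ω‖} := by
    intro ω hω
    by_cases h : ‖w ω‖ ≤ R
    · left
      have hω' : c < penalizedSup C g n (Δ ω, Γ ω) - g (w ω, w ω) := hω
      simp only [hf, mem_ofPred_eq, indicator_of_mem (show ω ∈ {ω | ‖w ω‖ ≤ R} from h), edist_dist,
        Real.dist_eq, sub_zero]
      exact ENNReal.ofReal_le_ofReal (hω'.le.trans (le_abs_self _))
    · exact Or.inr (not_le.1 h)
  refine (measure_mono hsub).trans ((measure_union_le _ _).trans ?_)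
  rw [two_mul, ENNReal.ofReal_add hκ.le hκ.le]
  exact add_le_add hn hR

/-- Upper semicontinuity of the law of pairs of asymptotic maximizers: if the scores converge stably
and the limit field has the unique maximizer `w`, pairs of asymptotic maximizers are asymptotically
dominated by `(w, w)`. -/
theorem eventually_integral_asympMaximizer_le (h𝒢 : 𝒢 ≤ mΩ) (hD : StableTendsto 𝒢 μ D l Δ)
    (hDm : ∀ i, Measurable (D i)) (hΔm : Measurable Δ) (hΓ : Measurable[𝒢] fun ω i j => Γ ω i j)
    (hU : IsClosed U) (h0 : 0 ∈ U) (hw : Measurable w) (hwU : ∀ ω, w ω ∈ U)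
    (hmax : ∀ᵐ ω ∂μ, ∀ u ∈ U, u ≠ w ω → logQuad (Δ ω) (Γ ω) u < logQuad (Δ ω) (Γ ω) (w ω))
    {x y : ι → Ω → Vec p} (hx : IsAsympMaximizer μ l U D Γ x) (hy : IsAsympMaximizer μ l U D Γ y)
    (hxm : ∀ᶠ i in l, Measurable (x i)) (hym : ∀ᶠ i in l, Measurable (y i))
    {g : Vec p × Vec p → ℝ} (hg : Continuous g) {B : ℝ} (hB0 : 0 ≤ B) (hB : ∀ z, |g z| ≤ B)
    {Z : Ω → ℝ} (hZ : Measurable[𝒢] Z) {C : ℝ} (hC0 : 0 ≤ C) (hZ0 : ∀ ω, 0 ≤ Z ω)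
    (hZC : ∀ ω, Z ω ≤ C) {ε : ℝ} (hε : 0 < ε) :
    ∀ᶠ i in l, ∫ ω, g (x i ω, y i ω) * Z ω ∂μ ≤ ∫ ω, g (w ω, w ω) * Z ω ∂μ + ε := by
  have hΓm : Measurable fun ω i j => Γ ω i j := hΓ.mono h𝒢 le_rfl
  have hZm : Measurable Z := hZ.mono h𝒢 le_rfl
  have hZabs : ∀ ω, |Z ω| ≤ C := fun ω => (abs_of_nonneg (hZ0 ω)).trans_le (hZC ω)
  -- Error budget: each of the two comparisons with `penalizedSup` costs `ε / 8 + ε / 4`, and the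
  -- stable limit costs `ε / 8`, in total less than `ε`.
  obtain ⟨κ, hκ, hκε⟩ : ∃ κ > 0, 2 * B * C * (2 * κ) ≤ ε / 4 := by
    refine ⟨ε / (16 * (B * C + 1)), by positivity, ?_⟩
    rw [show 2 * B * C * (2 * (ε / (16 * (B * C + 1)))) = (B * C / (B * C + 1)) * (ε / 4) by
      field_simp; ring]
    have : B * C / (B * C + 1) ≤ 1 := div_le_one_of_le₀ (by linarith) (by positivity)
    nlinarith
  obtain ⟨c, hc, hcε⟩ : ∃ c > 0, c * C ≤ ε / 8 := by
    refine ⟨ε / (8 * (C + 1)), by positivity, ?_⟩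
    rw [show ε / (8 * (C + 1)) * C = (C / (C + 1)) * (ε / 8) by field_simp]
    have : C / (C + 1) ≤ 1 := div_le_one_of_le₀ (by linarith) (by positivity)
    nlinarith
  obtain ⟨Rx, hRx⟩ := hx κ hκ
  obtain ⟨Ry, hRy⟩ := hy κ hκ
  obtain ⟨Rw, hRw⟩ := exists_forall_measure_norm_gt_le (μ := μ) hw
    (show (0 : ℝ≥0∞) < ENNReal.ofReal κ by simpa using hκ)
  set R := max (max Rx Ry) (max Rw 0) with hR
  have hR0 : 0 ≤ R := (le_max_right _ _).trans (le_max_right _ _)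
  set A := U ∩ Metric.closedBall (0 : Vec p) R with hAdef
  have hA : IsCompact A := (isCompact_closedBall 0 R).inter_left hU
  have hAne : A.Nonempty := ⟨0, h0, by simpa using hR0⟩
  obtain ⟨n, hn⟩ := exists_measure_penalizedSup_gt_le hU hΔm hΓm hw hwU hmax hg hκ hc
    (hRw R ((le_max_left _ _).trans (le_max_right _ _)))
  have hφB : ∀ x, |penalizedSup A g n x| ≤ B := fun x =>
    abs_penalizedSup_le hA hAne hg hB n.cast_nonneg x
  have hφΔ : Measurable fun ω => penalizedSup A g n (Δ ω, Γ ω) :=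
    measurable_penalizedSup hA hg n hΔm hΓm
  have hφD : ∀ i, Measurable fun ω => penalizedSup A g n (D i ω, Γ ω) := fun i =>
    measurable_penalizedSup hA hg n (hDm i) hΓm
  have hgw : Measurable fun ω => g (w ω, w ω) := hg.measurable.comp (hw.prodMk hw)
  have hlim : ∫ ω, penalizedSup A g n (Δ ω, Γ ω) * Z ω ∂μ
      ≤ ∫ ω, g (w ω, w ω) * Z ω ∂μ + (ε / 8 + ε / 4) := by
    have h := integral_mul_le_of_measure_le (μ := μ) (b := 2 * B) (hφΔ.sub hgw)
      (fun ω => (abs_sub _ _).trans (by linarith [hφB (Δ ω, Γ ω), hB (w ω, w ω)])) hZm hZ0 hZC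
      (by positivity) hc.le hC0 (by positivity) hn
    simp only [Pi.sub_apply, sub_mul] at h
    rw [integral_sub (integrable_mul_of_abs_le hφΔ (fun ω => hφB _) hZm hZabs)
      (integrable_mul_of_abs_le hgw (fun ω => hB _) hZm hZabs)] at h
    linarith
  have hstab := hD.tendsto_integral_prod h𝒢 hDm hΔm hΓ (continuous_penalizedSup_of hA hg n)
    (fun x => hφB _)
    (L := 2 * n * R ^ 2 * p) (by positivity) (fun s m m' => by
      refine (abs_penalizedSup_sub_le hA hAne hg (R := R) (fun u hu => by simpa using hu.2)
        n.cast_nonneg s (Matrix.of m) (Matrix.of m')).trans ?_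
      rw [mul_assoc _ (p : ℝ)]
      exact mul_le_mul_of_nonneg_left (frobNorm_of_sub_of_le_dist _ _) (by positivity)) hZ hZabs
  have hstab' := hstab.eventually_lt_const (u := ∫ ω, penalizedSup A g n (Δ ω, Γ ω) * Z ω ∂μ + ε / 8)
    (lt_add_of_pos_right _ (by linarith))
  -- Radius `R + 1` because `x` and `y` lie only within `η ≤ 1` of the ball of radius `R`; half of
  -- `c` pays for moving to `(z, z')`, the other half for the penalty `2 * n * η`.
  obtain ⟨η₁, hη₁, hunif⟩ := Metric.uniformContinuousOn_iff.1
    (((isCompact_closedBall (0 : Vec p) (R + 1)).prod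
      (isCompact_closedBall (0 : Vec p) (R + 1))).uniformContinuousOn_of_continuous hg.continuousOn)
    (c / 2) (half_pos hc)
  obtain ⟨η, hη, hη1, hηη₁, hηc⟩ : ∃ η > 0, η ≤ 1 ∧ η < η₁ ∧ 2 * n * η ≤ c / 2 := by
    refine ⟨min (min 1 (η₁ / 2)) (c / (4 * (n + 1))), by positivity, ?_, ?_, ?_⟩
    · exact (min_le_left _ _).trans (min_le_left _ _)
    · exact ((min_le_left _ _).trans (min_le_right _ _)).trans_lt (by linarith)
    · calc 2 * n * min (min 1 (η₁ / 2)) (c / (4 * (n + 1)))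
          ≤ 2 * n * (c / (4 * (n + 1))) := by gcongr; exact min_le_right _ _
        _ = (n / (n + 1)) * (c / 2) := by field_simp; ring
        _ ≤ 1 * (c / 2) := by
          gcongr
          exact div_le_one_of_le₀ (by linarith) (by positivity)
        _ = c / 2 := one_mul _
  filter_upwards [hstab', hxm, hym,
    hRx R ((le_max_left _ _).trans (le_max_left _ _)) η hη,
    hRy R ((le_max_right _ _).trans (le_max_left _ _)) η hη] with i hi hxi hyi hbx hby
  have hgi : Measurable fun ω => g (x i ω, y i ω) := hg.measurable.comp (hxi.prodMk hyi)
  have hbad : μ {ω | c < g (x i ω, y i ω) - penalizedSup A g n (D i ω, Γ ω)}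
      ≤ ENNReal.ofReal (2 * κ) := by
    rw [two_mul, ENNReal.ofReal_add hκ.le hκ.le]
    refine le_trans (measure_mono ?_) ((measure_union_le _ _).trans (add_le_add hbx hby))
    intro ω hω
    by_contra hcon
    simp only [mem_union, mem_ofPred_eq, not_or, not_not] at hcon
    obtain ⟨⟨z, hz, hxz, hzmax⟩, ⟨z', hz', hyz', hz'max⟩⟩ := hcon
    have h1 := sub_le_penalizedSup hA hg (K := n) n.cast_nonneg (x := (D i ω, Γ ω)) (z := (z, z'))
      ⟨hz, hz'⟩ hzmax hz'max
    have hball : ∀ {v z : Vec p}, z ∈ A → dist v z ≤ η → v ∈ Metric.closedBall 0 (R + 1) := by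
      intro v z hz hvz
      have := hz.2
      rw [Metric.mem_closedBall] at this ⊢
      linarith [dist_triangle v z 0]
    have h2 := hunif (x i ω, y i ω) ⟨hball hz hxz, hball hz' hyz'⟩ (z, z')
      ⟨Metric.closedBall_subset_closedBall (by linarith) hz.2,
        Metric.closedBall_subset_closedBall (by linarith) hz'.2⟩
      (by rw [Prod.dist_eq]; exact max_lt (hxz.trans_lt hηη₁) (hyz'.trans_lt hηη₁))
    rw [Real.dist_eq, abs_lt] at h2
    have hω' : c < g (x i ω, y i ω) - penalizedSup A g n (D i ω, Γ ω) := hω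
    linarith [h2.2]
  have h := integral_mul_le_of_measure_le (μ := μ) (b := 2 * B) (hgi.sub (hφD i))
    (fun ω => (abs_sub _ _).trans (by linarith [hφB (D i ω, Γ ω), hB (x i ω, y i ω)])) hZm hZ0 hZC
    (by positivity) hc.le hC0 (by positivity) hbad
  simp only [Pi.sub_apply, sub_mul] at h
  rw [integral_sub (integrable_mul_of_abs_le hgi (fun ω => hB _) hZm hZabs)
    (integrable_mul_of_abs_le (hφD i) (fun ω => hφB _) hZm hZabs)] at h
  have hi' : ∫ ω, penalizedSup A g n (D i ω, Γ ω) * Z ω ∂μ <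
      ∫ ω, penalizedSup A g n (Δ ω, Γ ω) * Z ω ∂μ + ε / 8 := hi
  linarith

end ArgmaxConvergence

/-! ### Calculus of events of large outer probability. -/

/-- Along `l`, the predicate `P i` eventually fails with outer probability at most `κ`. -/
def EventuallyProb {Ω ι : Type*} [MeasurableSpace Ω] (μ : Measure Ω) (l : Filter ι) (κ : ℝ)
    (P : ι → Ω → Prop) : Prop :=
  ∀ᶠ i in l, μ {ω | ¬ P i ω} ≤ ENNReal.ofReal κ

section EventuallyProb

variable {Ω ι : Type*} [MeasurableSpace Ω] {μ : Measure Ω} {l : Filter ι} {P Q : ι → Ω → Prop}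
  {κ κ' : ℝ}

lemma EventuallyProb.and (hP : EventuallyProb μ l κ P) (hQ : EventuallyProb μ l κ' Q)
    (hκ : 0 ≤ κ) (hκ' : 0 ≤ κ') : EventuallyProb μ l (κ + κ') fun i ω => P i ω ∧ Q i ω := by
  filter_upwards [hP, hQ] with i h1 h2
  rw [ENNReal.ofReal_add hκ hκ']
  refine (measure_mono ?_).trans ((measure_union_le _ _).trans (add_le_add h1 h2))
  intro ω hω
  exact not_and_or.1 hω

lemma EventuallyProb.mono (hP : EventuallyProb μ l κ P) (h : ∀ᶠ i in l, ∀ ω, P i ω → Q i ω) :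
    EventuallyProb μ l κ Q := by
  filter_upwards [hP, h] with i h1 h2
  exact (measure_mono fun ω (hω : ¬ Q i ω) hPω => hω (h2 ω hPω)).trans h1

lemma TendstoZeroInProb.eventuallyProb_lt {X : ι → Ω → ℝ≥0∞} (hX : TendstoZeroInProb μ X l)
    {c : ℝ} (hc : 0 < c) (hκ : 0 < κ) :
    EventuallyProb μ l κ fun i ω => X i ω < ENNReal.ofReal c := by
  have h := (hX (ENNReal.ofReal c) (by simpa using hc)).eventually_le_const
    (show (0 : ℝ≥0∞) < ENNReal.ofReal κ by simpa using hκ)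
  simpa only [EventuallyProb, not_lt] using h

lemma TendstoZeroInProb.eventuallyProb_forall_lt {α : Type*} {s : Set α} {f : ι → Ω → α → ℝ}
    (h : TendstoZeroInProb μ (fun i ω => ⨆ x ∈ s, ENNReal.ofReal (f i ω x)) l) {c : ℝ}
    (hc : 0 < c) (hκ : 0 < κ) : EventuallyProb μ l κ fun i ω => ∀ x ∈ s, f i ω x < c :=
  (h.eventuallyProb_lt hc hκ).mono (Eventually.of_forall fun i ω hω x hx =>
    (ENNReal.ofReal_lt_ofReal_iff hc).1
      ((le_iSup₂ (f := fun x (_ : x ∈ s) => ENNReal.ofReal (f i ω x)) x hx).trans_lt hω))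

lemma TendstoZeroInProb.eventuallyProb_forall₂_lt {α β : Type*} {s : ι → Set α} {t : Set β}
    {f : ι → Ω → α → β → ℝ}
    (h : TendstoZeroInProb μ (fun i ω => ⨆ x ∈ s i, ⨆ y ∈ t, ENNReal.ofReal (f i ω x y)) l) {c : ℝ}
    (hc : 0 < c) (hκ : 0 < κ) :
    EventuallyProb μ l κ fun i ω => ∀ x ∈ s i, ∀ y ∈ t, f i ω x y < c :=
  (h.eventuallyProb_lt hc hκ).mono (Eventually.of_forall fun i ω hω x hx y hy =>
    (ENNReal.ofReal_lt_ofReal_iff hc).1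
      (((le_iSup₂ (f := fun y (_ : y ∈ t) => ENNReal.ofReal (f i ω x y)) y hy).trans
        (le_iSup₂ (f := fun x (_ : x ∈ s i) => ⨆ y ∈ t, ENNReal.ofReal (f i ω x y)) x hx)).trans_lt
          hω))

end EventuallyProb

/-- A family which converges to zero in probability is dominated, in probability, by a deterministic
positive family tending to zero. -/
lemma exists_rate_of_tendsto_prob {Ω : Type*} [MeasurableSpace Ω] {μ : Measure Ω}
    [IsProbabilityMeasure μ] {𝕋 : Set ℝ} (h𝕋 : ¬ BddAbove 𝕋) {X : 𝕋 → Ω → ℝ}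
    (hX : ∀ c > 0, ∀ κ > 0, EventuallyProb μ atTop κ fun T ω => X T ω < c) :
    ∃ δ : 𝕋 → ℝ, (∀ T, 0 < δ T) ∧ Tendsto δ atTop (𝓝 0) ∧
      ∀ κ > 0, EventuallyProb μ atTop κ fun T ω => X T ω < δ T := by
  -- The infimum of `S T` is a Ky Fan type distance of `X T` to zero. Adding the vanishing positive
  -- `s T` keeps the rate positive and puts some element of `S T` strictly below it.
  set S : 𝕋 → Set ℝ := fun T => {c | 0 ≤ c ∧ μ {ω | ¬ X T ω < c} ≤ ENNReal.ofReal c} with hS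
  have hne : ∀ T, (S T).Nonempty := fun T => ⟨1, zero_le_one, by simpa using prob_le_one⟩
  have hbdd : ∀ T, BddBelow (S T) := fun T => ⟨0, fun c hc => hc.1⟩
  have hd0 : ∀ T, 0 ≤ sInf (S T) := fun T => le_csInf (hne T) fun c hc => hc.1
  set s : 𝕋 → ℝ := fun T => (1 + |(T : ℝ)|)⁻¹ with hs
  have hspos : ∀ T, 0 < s T := fun T => by positivity
  have hs0 : Tendsto s atTop (𝓝 0) := tendsto_inv_atTop_zero.comp (tendsto_atTop_add_const_left _ _
    (tendsto_abs_atTop_atTop.comp (tendsto_coe_atTop_of_not_bddAbove h𝕋)))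
  have hd : Tendsto (fun T => sInf (S T)) atTop (𝓝 0) := by
    rw [Metric.tendsto_nhds]
    intro ε hε
    filter_upwards [hX (ε / 2) (half_pos hε) (ε / 2) (half_pos hε)] with T hT
    have : sInf (S T) ≤ ε / 2 := csInf_le (hbdd T) ⟨(half_pos hε).le, hT⟩
    rw [Real.dist_eq, sub_zero, abs_of_nonneg (hd0 T)]
    linarith
  have hδ : Tendsto (fun T => sInf (S T) + s T) atTop (𝓝 0) := by simpa using hd.add hs0
  refine ⟨fun T => sInf (S T) + s T, fun T => add_pos_of_nonneg_of_pos (hd0 T) (hspos T), hδ,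
    fun κ hκ => ?_⟩
  filter_upwards [hδ.eventually_le_const hκ] with T hT
  obtain ⟨c, hc, hcT⟩ := exists_lt_of_csInf_lt (hne T) (lt_add_of_pos_right _ (hspos T))
  refine (measure_mono fun ω (hω : ¬ X T ω < _) hXω => hω (lt_trans hXω hcT)).trans (hc.2.trans ?_)
  exact ENNReal.ofReal_le_ofReal (hcT.le.trans hT)

lemma StableTendsto.exists_eventuallyProb_norm_le {Ω ι E : Type*} {𝒢 : MeasurableSpace Ω}
    [mΩ : MeasurableSpace Ω] {μ : Measure Ω} [IsProbabilityMeasure μ] [NormedAddCommGroup E]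
    [MeasurableSpace E] [BorelSpace E] {l : Filter ι} {D : ι → Ω → E} {Δ : Ω → E}
    (h : StableTendsto 𝒢 μ D l Δ) (hD : ∀ i, Measurable (D i)) (hΔ : Measurable Δ) {κ : ℝ}
    (hκ : 0 < κ) : ∃ L : ℝ, EventuallyProb μ l κ fun i ω => ‖D i ω‖ ≤ L := by
  obtain ⟨R, hR⟩ := exists_forall_measure_norm_gt_le (μ := μ) hΔ
    (show (0 : ℝ≥0∞) < ENNReal.ofReal (κ / 2) by simpa using hκ)
  -- A continuous function lying between the indicators of `‖x‖ > R + 1` and `‖x‖ > R`, so that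
  -- convergence of its mean transfers the tail bound from `Δ` to `D`.
  set ψ : E → ℝ := fun x => min 1 (max 0 (‖x‖ - R)) with hψ
  have hψc : Continuous ψ := by fun_prop
  have hψ0 : ∀ x, 0 ≤ ψ x := fun x => le_min zero_le_one (le_max_left _ _)
  have hψ1 : ∀ x, ψ x ≤ 1 := fun x => min_le_left _ _
  have hψabs : ∀ x, |ψ x| ≤ 1 := fun x => (abs_of_nonneg (hψ0 x)).trans_le (hψ1 x)
  have hlim : Tendsto (fun i => ∫ ω, ψ (D i ω) ∂μ) l (𝓝 (∫ ω, ψ (Δ ω) ∂μ)) := by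
    simpa using h (BoundedContinuousFunction.ofNormedAddCommGroup ψ hψc 1 hψabs) (fun _ => 1)
      measurable_const ⟨1, by simp⟩
  have hint : ∀ {f : Ω → E}, Measurable f → Integrable (fun ω => ψ (f ω)) μ := fun hf =>
    Integrable.of_bound (hψc.measurable.comp hf).aestronglyMeasurable 1
      (ae_of_all _ fun ω => hψabs _)
  have hlt : ∫ ω, ψ (Δ ω) ∂μ < κ := by
    have hs : MeasurableSet {ω | R < ‖Δ ω‖} := measurableSet_lt measurable_const hΔ.norm
    have h1 : ∫ ω, ψ (Δ ω) ∂μ ≤ ∫ ω, indicator {ω | R < ‖Δ ω‖} (fun _ => (1 : ℝ)) ω ∂μ := by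
      refine integral_mono (hint hΔ) ((integrable_const _).indicator hs) fun ω => ?_
      by_cases hω : R < ‖Δ ω‖
      · rw [indicator_of_mem (by exact hω)]; exact hψ1 _
      · rw [indicator_of_notMem (by exact hω)]
        exact (min_le_right _ _).trans (max_le le_rfl (by linarith))
    rw [integral_indicator_const _ hs] at h1
    have h2 : μ.real {ω | R < ‖Δ ω‖} ≤ κ / 2 :=
      ENNReal.toReal_le_of_le_ofReal (half_pos hκ).le (hR R le_rfl)
    simp only [smul_eq_mul, mul_one] at h1
    linarith
  refine ⟨R + 1, ?_⟩
  filter_upwards [hlim.eventually_lt_const hlt] with i hi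
  have hs : MeasurableSet {ω | ¬ ‖D i ω‖ ≤ R + 1} :=
    (measurableSet_le (hD i).norm measurable_const).compl
  have h1 : ∫ ω, indicator {ω | ¬ ‖D i ω‖ ≤ R + 1} (fun _ => (1 : ℝ)) ω ∂μ ≤
      ∫ ω, ψ (D i ω) ∂μ := by
    refine integral_mono ((integrable_const _).indicator hs) (hint (hD i)) fun ω => ?_
    by_cases hω : ‖D i ω‖ ≤ R + 1
    · rw [indicator_of_notMem (by simpa using hω)]; exact hψ0 _
    · rw [indicator_of_mem (by exact hω)]
      exact le_min le_rfl (le_max_of_le_right (by linarith))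
  rw [integral_indicator_const _ hs] at h1
  simp only [smul_eq_mul, mul_one] at h1
  rw [← ENNReal.ofReal_toReal (measure_ne_top μ {ω | ¬ ‖D i ω‖ ≤ R + 1})]
  exact ENNReal.ofReal_le_ofReal (h1.trans hi.le)

lemma exists_measure_le_of_antitone {Ω : Type*} [MeasurableSpace Ω] {μ : Measure Ω}
    [IsFiniteMeasure μ] {A : ℕ → Set Ω} (hA : ∀ n, MeasurableSet (A n)) (hanti : Antitone A)
    (h0 : ∀ᵐ ω ∂μ, ∃ n, ω ∉ A n) {κ : ℝ} (hκ : 0 < κ) :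
    ∃ n, μ (A n) ≤ ENNReal.ofReal κ := by
  have h := tendsto_measure_iInter_atTop (μ := μ) (fun n => (hA n).nullMeasurableSet) hanti
    ⟨0, measure_ne_top _ _⟩
  have hz : μ (⋂ n, A n) = 0 := by
    rw [← compl_compl (⋂ n, A n), ← mem_ae_iff]
    filter_upwards [h0] with ω hω
    simpa using hω
  rw [hz] at h
  exact (h.eventually_le_const (show (0 : ℝ≥0∞) < ENNReal.ofReal κ by simpa using hκ)).exists

/-- Almost every `Γ ω` has its own coercivity constant; continuity of the measure from above, along
`1 / (n + 1)`, makes it deterministic off a small event. -/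
lemma exists_pos_measure_not_coercive_le {Ω : Type*} [MeasurableSpace Ω] {μ : Measure Ω}
    [IsFiniteMeasure μ] {p : ℕ} {Γ : Ω → Mat p} (hΓ : Measurable fun ω i j => Γ ω i j)
    (hpos : ∀ᵐ ω ∂μ, (Γ ω).PosDef) {κ : ℝ} (hκ : 0 < κ) :
    ∃ c > 0, μ {ω | ¬ ∀ u : Vec p, c * ‖u‖ ^ 2 ≤ inner ℝ u (Matrix.toEuclideanLin (Γ ω) u)} ≤
      ENNReal.ofReal κ := by
  have hmeas : ∀ c : ℝ, MeasurableSet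
      {ω | ∀ u : Vec p, c * ‖u‖ ^ 2 ≤ inner ℝ u (Matrix.toEuclideanLin (Γ ω) u)} := by
    intro c
    have hcl : IsClosed {m : Fin p → Fin p → ℝ | ∀ u : Vec p,
        c * ‖u‖ ^ 2 ≤ inner ℝ u (Matrix.toEuclideanLin (Matrix.of m) u)} := by
      simp only [Set.ofPred_forall]
      refine isClosed_iInter fun u => isClosed_le continuous_const (continuous_const.inner ?_)
      exact continuous_toEuclideanLin.comp ((continuous_matrix fun i j => by
        simp only [Matrix.of_apply]; fun_prop).prodMk continuous_const)
    exact hΓ hcl.measurableSet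
  obtain ⟨n, hn⟩ := exists_measure_le_of_antitone (μ := μ)
    (A := fun n : ℕ => {ω | ¬ ∀ u : Vec p,
      1 / ((n : ℝ) + 1) * ‖u‖ ^ 2 ≤ inner ℝ u (Matrix.toEuclideanLin (Γ ω) u)})
    (fun n => (hmeas _).compl)
    (fun m n hmn ω hω hm => hω fun u => le_trans (by gcongr) (hm u)) (by
      filter_upwards [hpos] with ω hω
      obtain ⟨c, hc, hcu⟩ := hω.exists_pos_mul_sq_norm_le
      obtain ⟨n, hn⟩ := exists_nat_one_div_lt hc
      refine ⟨n, not_not.2 fun u => le_trans ?_ (hcu u)⟩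
      exact mul_le_mul_of_nonneg_right hn.le (sq_nonneg _)) hκ
  exact ⟨_, by positivity, hn⟩

/-- On the compact `K` the continuous field attains its maximum, almost surely negative, and a
countable dense subset makes the exceedance events measurable. -/
lemma exists_pos_measure_exists_gt_le {Ω E : Type*} [MeasurableSpace Ω] {μ : Measure Ω}
    [IsFiniteMeasure μ] [PseudoMetricSpace E] {K : Set E} (hK : IsCompact K) {Y : Ω → E → ℝ}
    (hY : ∀ θ ∈ K, Measurable fun ω => Y ω θ) (hYc : ∀ ω, ContinuousOn (Y ω) K)
    (hneg : ∀ᵐ ω ∂μ, ∀ θ ∈ K, Y ω θ < 0) {κ : ℝ} (hκ : 0 < κ) :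
    ∃ c > 0, μ {ω | ∃ θ ∈ K, -c < Y ω θ} ≤ ENNReal.ofReal κ := by
  obtain ⟨Q, hQK, hQc, hQd⟩ := hK.isSeparable.exists_countable_dense_subset
  have hsub : ∀ (c : ℝ) ω θ, θ ∈ K → c < Y ω θ → ∃ θ' ∈ Q, c < Y ω θ' := by
    intro c ω θ hθ hc
    have h1 : ∀ᶠ x in 𝓝[K] θ, c < Y ω x := (hYc ω θ hθ).eventually_const_lt hc
    have h2 : (𝓝[Q] θ).NeBot := mem_closure_iff_nhdsWithin_neBot.1 (hQd hθ)
    obtain ⟨x, hx, hxQ⟩ := ((h1.filter_mono (nhdsWithin_mono θ hQK)).and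
      self_mem_nhdsWithin).exists
    exact ⟨x, hxQ, hx⟩
  have heq : ∀ c : ℝ, {ω | ∃ θ ∈ K, c < Y ω θ} = ⋃ θ ∈ Q, {ω | c < Y ω θ} := by
    intro c
    ext ω
    simp only [mem_ofPred_eq, mem_iUnion, exists_prop]
    exact ⟨fun ⟨θ, hθ, h⟩ => hsub c ω θ hθ h, fun ⟨θ, hθ, h⟩ => ⟨θ, hQK hθ, h⟩⟩
  obtain ⟨n, hn⟩ := exists_measure_le_of_antitone (μ := μ)
    (A := fun n : ℕ => {ω | ∃ θ ∈ K, -(1 / ((n : ℝ) + 1)) < Y ω θ})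
    (fun n => by
      rw [heq]
      exact MeasurableSet.biUnion hQc fun θ hθ =>
        measurableSet_lt measurable_const (hY θ (hQK hθ)))
    (fun m n hmn ω ⟨θ, hθ, h⟩ => ⟨θ, hθ, lt_of_le_of_lt (neg_le_neg (by gcongr)) h⟩) (by
      filter_upwards [hneg] with ω hω
      rcases K.eq_empty_or_nonempty with h | h
      · exact ⟨0, by simp [h]⟩
      obtain ⟨θ, hθ, hmax⟩ := hK.exists_isMaxOn h (hYc ω)
      obtain ⟨n, hn⟩ := exists_nat_one_div_lt (show 0 < -Y ω θ by linarith [hω θ hθ])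
      refine ⟨n, ?_⟩
      rintro ⟨θ', hθ', h'⟩
      have : Y ω θ' ≤ Y ω θ := hmax hθ'
      linarith) hκ
  exact ⟨_, by positivity, hn⟩

/-! ### Deterministic estimates for almost maximizers. -/

section LocalMaximizer

variable {p : ℕ} {V : Set (Vec p)} {F : Vec p → ℝ} {D D' : Vec p} {G : Mat p}
  {v : Vec p} {L c r e R : ℝ}

/-- An almost maximizer of a locally asymptotically quadratic field is bounded. -/
lemma norm_le_of_almost_maximal
    (hquad : |F v - logQuad D' G v| ≤ r / 2 * ‖v‖ ^ 2) (hF0 : 0 ≤ F v + 1)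
    (hD : ‖D‖ ≤ L) (hDD' : ‖D' - D‖ ≤ 1) (hc : 0 < c) (hrc : r ≤ c / 2)
    (hcoer : c * ‖v‖ ^ 2 ≤ inner ℝ v (Matrix.toEuclideanLin G v)) :
    ‖v‖ ≤ max 1 (4 * (L + 2) / c) := by
  by_contra! h
  obtain ⟨h1, h2⟩ := max_lt_iff.1 h
  rw [div_lt_iff₀ hc] at h2
  have h3 : inner ℝ D' v ≤ (L + 1) * ‖v‖ := by
    refine (real_inner_le_norm _ _).trans (mul_le_mul_of_nonneg_right ?_ (norm_nonneg v))
    calc ‖D'‖ = ‖(D' - D) + D‖ := by rw [sub_add_cancel]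
      _ ≤ L + 1 := (norm_add_le _ _).trans (by linarith)
  have h4 := (abs_le.1 hquad).2
  unfold logQuad at h4
  have h5 : r / 2 * ‖v‖ ^ 2 ≤ c / 4 * ‖v‖ ^ 2 :=
    mul_le_mul_of_nonneg_right (by linarith) (sq_nonneg _)
  -- The hypotheses give `c / 4 * ‖v‖ ^ 2 ≤ (L + 1) * ‖v‖ + 1`, and the right side is at most `(L +
  -- 2) * ‖v‖` when `‖v‖ > 1`.
  nlinarith

/-- An almost maximizer over the set `V` of a locally asymptotically quadratic field is close to an
almost maximizer of the quadratic field over any set close to `V`. -/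
lemma exists_near_almost_maximal {U : Set (Vec p)} {η η' ρ : ℝ}
    (hquad : ∀ u ∈ V, ‖u‖ ≤ R + 1 → |F u - logQuad D' G u| ≤ r / 2 * ‖u‖ ^ 2)
    (hv : v ∈ V) (hFmax : ∀ u ∈ V, F u ≤ F v + e) (hvρ : ‖v‖ ≤ ρ) (hρR : ρ + 1 ≤ R)
    (hD : ‖D‖ ≤ L) (hG : frobNorm G ≤ L) {d : ℝ} (hDD' : ‖D' - D‖ ≤ d) (hr : 0 ≤ r)
    (hVU : ∀ u ∈ V, u ∈ Metric.closedBall 0 R → ∃ x ∈ U, dist u x < η')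
    (hUV : ∀ x ∈ U ∩ Metric.closedBall 0 R, ∃ u ∈ V, dist x u < η')
    (hη'1 : η' ≤ 1) (hη'η : η' ≤ η)
    (hsum : 2 * (L * (R + 2) * η') + 2 * (d * (R + 1)) + r * (R + 1) ^ 2 + e ≤ η) :
    ∃ z ∈ U ∩ Metric.closedBall 0 R, dist v z ≤ η ∧
      ∀ u ∈ U ∩ Metric.closedBall 0 R, logQuad D G u ≤ logQuad D G z + η := by
  have hL : 0 ≤ L := (norm_nonneg D).trans hD
  have hd : 0 ≤ d := (norm_nonneg _).trans hDD'
  have hR : 0 ≤ R := by linarith [norm_nonneg v]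
  have hnear : ∀ {x y : Vec p}, dist x y < η' → ‖y‖ ≤ ‖x‖ + 1 := by
    intro x y hxy
    have := norm_le_norm_add_norm_sub' y x
    rw [← dist_eq_norm, dist_comm] at this
    linarith
  have hq : ∀ {x y : Vec p}, ‖x‖ ≤ R + 1 → ‖y‖ ≤ R + 1 → dist x y < η' →
      logQuad D G x ≤ logQuad D G y + L * (R + 2) * η' := by
    intro x y hx hy hxy
    have h1 := (abs_le.1 (abs_logQuad_sub_le_of_point hD hG hx hy)).2
    rw [← dist_eq_norm] at h1
    have h2 : L * (1 + (R + 1)) * dist x y ≤ L * (R + 2) * η' := by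
      rw [show 1 + (R + 1) = R + 2 by ring]
      gcongr
    linarith
  have hscore : ∀ {u : Vec p}, ‖u‖ ≤ R + 1 → |logQuad D' G u - logQuad D G u| ≤ d * (R + 1) :=
    fun hu => (abs_logQuad_sub_le_of_score _ _ _ _).trans (by gcongr)
  have hquad' : ∀ u ∈ V, ‖u‖ ≤ R + 1 → |F u - logQuad D' G u| ≤ r / 2 * (R + 1) ^ 2 :=
    fun u hu hu' => (hquad u hu hu').trans (by gcongr)
  have hvR : ‖v‖ ≤ R + 1 := by linarith
  obtain ⟨z, hz, hvz⟩ := hVU v hv (by rw [mem_closedBall_zero_iff]; linarith)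
  have hzR : ‖z‖ ≤ R := by linarith [hnear hvz]
  refine ⟨z, ⟨hz, by simpa using hzR⟩, hvz.le.trans hη'η, fun u hu => ?_⟩
  obtain ⟨u', hu', huu'⟩ := hUV u hu
  have huR : ‖u‖ ≤ R := by simpa using hu.2
  have hu'R : ‖u'‖ ≤ R + 1 := by linarith [hnear huu']
  -- The chain runs from `u` to `u' ∈ V`, from `D` to `D'`, from `logQuad` to `F`, uses maximality
  -- at `v`, and returns symmetrically to `z`; the losses add up to the left side of `hsum`.
  have e1 := hq (by linarith) hu'R huu'
  have e2 := (abs_le.1 (hscore hu'R)).1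
  have e3 := (abs_le.1 (hquad' u' hu' hu'R)).1
  have e4 := hFmax u' hu'
  have e5 := (abs_le.1 (hquad' v hv hvR)).2
  have e6 := (abs_le.1 (hscore hvR)).2
  have e7 := hq hvR (by linarith) hvz
  linarith

end LocalMaximizer

/-- The four summands of the last bound are each made at most `η / 4`. -/
lemma exists_pos_constants {η R L c : ℝ} (hη : 0 < η) (hR : 0 ≤ R) (hL : 0 ≤ L) (hc : 0 < c) :
    ∃ η' > 0, ∃ d > 0, ∃ r > 0, ∃ e > 0, η' ≤ 1 ∧ η' ≤ η ∧ d ≤ 1 ∧ r ≤ c / 2 ∧ e ≤ 1 ∧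
      2 * (L * (R + 2) * η') + 2 * (d * (R + 1)) + r * (R + 1) ^ 2 + e ≤ η := by
  refine ⟨min (min 1 η) (η / (8 * ((L + 1) * (R + 2)))), by positivity,
    min 1 (η / (8 * (R + 1))), by positivity, min (c / 2) (η / (4 * (R + 1) ^ 2)), by positivity,
    min 1 (η / 4), by positivity, (min_le_left _ _).trans (min_le_left _ _),
    (min_le_left _ _).trans (min_le_right _ _), min_le_left _ _, min_le_left _ _, min_le_left _ _,
    ?_⟩
  have h1 : L * (R + 2) * min (min 1 η) (η / (8 * ((L + 1) * (R + 2)))) ≤ η / 8 := by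
    calc _ ≤ (L + 1) * (R + 2) * (η / (8 * ((L + 1) * (R + 2)))) := by
          gcongr
          · linarith
          · exact min_le_right _ _
      _ = η / 8 := by field_simp
  have h2 : min 1 (η / (8 * (R + 1))) * (R + 1) ≤ η / 8 := by
    calc _ ≤ η / (8 * (R + 1)) * (R + 1) := by gcongr; exact min_le_right _ _
      _ = η / 8 := by field_simp
  have h3 : min (c / 2) (η / (4 * (R + 1) ^ 2)) * (R + 1) ^ 2 ≤ η / 4 := by
    calc _ ≤ η / (4 * (R + 1) ^ 2) * (R + 1) ^ 2 := by gcongr; exact min_le_right _ _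
      _ = η / 4 := by field_simp
  have h4 : min 1 (η / 4) ≤ η / 4 := min_le_right _ _
  linarith

/-! ### Consistency, and asymptotic maximality of the estimators. -/

/-- Consistency of approximate maximizers. -/
lemma eventuallyProb_norm_sub_lt_of_contrast {Ω : Type*} [MeasurableSpace Ω] {μ : Measure Ω}
    [IsFiniteMeasure μ] {p : ℕ} {ι β : Type*} {l : Filter ι} {Θ : Set (Vec p)} (hΘ : IsCompact Θ)
    {θs : Vec p} (hθs : θs ∈ Θ) {𝒯 : Set β} {H : ι → Ω → Vec p → β → ℝ} {τhat : ι → Ω → β}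
    (hτ : ∀ i ω, τhat i ω ∈ 𝒯) {θhat : ι → Ω → Vec p} (hθ : ∀ i ω, θhat i ω ∈ Θ)
    (hgap : ∀ c > 0, ∀ κ > 0, EventuallyProb μ l κ fun i ω =>
      ∀ θ ∈ Θ, H i ω θ (τhat i ω) - H i ω (θhat i ω) (τhat i ω) < c)
    {Y : Ω → Vec p → ℝ} (hY : ∀ θ ∈ Θ, Measurable fun ω => Y ω θ)
    (hYc : ∀ ω, ContinuousOn (Y ω) Θ) (hneg : ∀ᵐ ω ∂μ, ∀ θ ∈ Θ, θ ≠ θs → Y ω θ < 0)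
    {b : ι → ℝ} (hb : ∀ᶠ i in l, b i ∈ Icc 0 1)
    (hunif : ∀ c > 0, ∀ κ > 0, EventuallyProb μ l κ fun i ω =>
      ∀ θ ∈ Θ, ∀ τ ∈ 𝒯, |b i * (H i ω θ τ - H i ω θs τ) - Y ω θ| < c)
    {ε : ℝ} (hε : 0 < ε) {κ : ℝ} (hκ : 0 < κ) :
    EventuallyProb μ l κ fun i ω => ‖θhat i ω - θs‖ < ε := by
  set K := Θ ∩ {θ | ε ≤ ‖θ - θs‖} with hK
  have hKc : IsCompact K := hΘ.inter_right (isClosed_le continuous_const (by fun_prop))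
  obtain ⟨c, hc, hcK⟩ := exists_pos_measure_exists_gt_le (μ := μ) hKc (Y := Y)
    (fun θ hθ => hY θ hθ.1) (fun ω => (hYc ω).mono inter_subset_left) (by
      filter_upwards [hneg] with ω hω θ hθ
      refine hω θ hθ.1 ?_
      rintro rfl
      have : ε ≤ ‖θ - θ‖ := hθ.2
      simp at this
      linarith) (show 0 < κ / 3 by linarith)
  have hcK' : EventuallyProb μ l (κ / 3) fun _ ω => ∀ θ ∈ K, Y ω θ ≤ -c :=
    Eventually.of_forall fun _ => by simpa using hcK
  have h := (hcK'.and ((hgap (c / 2) (half_pos hc) (κ / 3) (by linarith)).and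
    (hunif (c / 2) (half_pos hc) (κ / 3) (by linarith)) (by linarith) (by linarith))
      (by linarith) (by linarith)).mono (Q := fun i ω => ‖θhat i ω - θs‖ < ε) (by
    filter_upwards [hb] with i hbi ω hω
    obtain ⟨h1, h2, h3⟩ := hω
    by_contra! hcon
    have e1 := h1 _ ⟨hθ i ω, hcon⟩
    have e2 := h2 θs hθs
    have e3 := (abs_lt.1 (h3 _ (hθ i ω) _ (hτ i ω))).2
    -- A positive gap is not enlarged because `b i ≤ 1`, and a nonpositive one contributes at most
    -- zero because `b i ≥ 0`.
    have e4 : b i * (H i ω θs (τhat i ω) - H i ω (θhat i ω) (τhat i ω)) ≤ c / 2 := by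
      rcases le_total 0 (H i ω θs (τhat i ω) - H i ω (θhat i ω) (τhat i ω)) with h | h
      · nlinarith [hbi.1, hbi.2]
      · nlinarith [hbi.1, hbi.2]
    linarith)
  have hsum : κ / 3 + (κ / 3 + κ / 3) = κ := by ring
  rwa [hsum] at h

/-- Approximate maximizers over the sets `UT` of a locally asymptotically quadratic random field are
asymptotic maximizers of the quadratic field over the limit of these sets. -/
theorem isAsympMaximizer_of_locally_quadratic {Ω : Type*} [MeasurableSpace Ω] {μ : Measure Ω}
    [IsProbabilityMeasure μ] {p : ℕ} {𝕋 : Set ℝ} (h𝕋 : ¬ BddAbove 𝕋) {UT : 𝕋 → Set (Vec p)}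
    (hUT : outerLimitSet UT ⊆ limitSet UT) (h0 : ∀ T, 0 ∈ UT T)
    {F : 𝕋 → Ω → Vec p → ℝ} (hF0 : ∀ T ω, F T ω 0 = 0) {D D' : 𝕋 → Ω → Vec p} {Γ : Ω → Mat p}
    (hD : ∀ κ > 0, ∃ L : ℝ, EventuallyProb μ atTop κ fun T ω => ‖D T ω‖ ≤ L)
    (hDD' : ∀ d > 0, ∀ κ > 0, EventuallyProb μ atTop κ fun T ω => ‖D' T ω - D T ω‖ < d)
    (hΓ : Measurable fun ω i j => Γ ω i j) (hpos : ∀ᵐ ω ∂μ, (Γ ω).PosDef)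
    {x : 𝕋 → Ω → Vec p} (hx : ∀ T ω, x T ω ∈ UT T)
    (hmax : ∀ e > 0, ∀ κ > 0, EventuallyProb μ atTop κ fun T ω =>
      ∀ u ∈ UT T, F T ω u ≤ F T ω (x T ω) + e)
    (hquad : ∀ (R : ℝ), ∀ r > 0, ∀ κ > 0, EventuallyProb μ atTop κ fun T ω =>
      ∀ u ∈ UT T, ‖u‖ ≤ R ∨ u = x T ω →
        |F T ω u - logQuad (D' T ω) (Γ ω) u| ≤ r / 2 * ‖u‖ ^ 2) :
    IsAsympMaximizer μ atTop (limitSet UT) D Γ x := by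
  intro ε hε
  set κ := ε / 6 with hκdef
  have hκ : 0 < κ := by positivity
  obtain ⟨L₁, hL₁⟩ := hD κ hκ
  have hfrob : Measurable fun ω => frobNorm (Γ ω) := by
    have hcont : Continuous fun m : Fin p → Fin p → ℝ => frobNorm (Matrix.of m) :=
      continuous_frobNorm.comp (continuous_matrix fun i j => by
        simp only [Matrix.of_apply]; fun_prop)
    exact hcont.measurable.comp hΓ
  obtain ⟨L₂, hL₂⟩ := exists_forall_measure_norm_gt_le (μ := μ) hfrob
    (show (0 : ℝ≥0∞) < ENNReal.ofReal κ by simpa using hκ)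
  obtain ⟨c, hc, hcoer⟩ := exists_pos_measure_not_coercive_le (μ := μ) hΓ hpos hκ
  set L := max 0 (max L₁ L₂) with hLdef
  have hL0 : 0 ≤ L := le_max_left _ _
  have hΓL : EventuallyProb μ (atTop : Filter 𝕋) κ fun _ ω => frobNorm (Γ ω) ≤ L := by
    refine Eventually.of_forall fun _ => le_trans (measure_mono fun ω hω => ?_) (hL₂ L₂ le_rfl)
    have h1 : L < frobNorm (Γ ω) := not_le.1 hω
    have h2 : L₂ ≤ L := (le_max_right _ _).trans (le_max_right _ _)
    exact (h2.trans_lt h1).trans_le (le_abs_self _)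
  have hcoer' : EventuallyProb μ (atTop : Filter 𝕋) κ fun _ ω =>
      ∀ u : Vec p, c * ‖u‖ ^ 2 ≤ inner ℝ u (Matrix.toEuclideanLin (Γ ω) u) :=
    Eventually.of_forall fun _ => hcoer
  -- The bound depends on `ε` only, through `L` and `c`, so the threshold radius is chosen before
  -- `R` and `η`.
  set ρ := max 1 (4 * (L + 2) / c) with hρdef
  refine ⟨ρ + 1, fun R hR η hη => ?_⟩
  have hR0 : 0 ≤ R := by
    have : 1 ≤ ρ := le_max_left _ _
    linarith
  obtain ⟨η', hη', d, hd, r, hr, e, he, hη'1, hη'η, hd1, hrc, he1, hsum⟩ :=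
    exists_pos_constants hη hR0 hL0 hc
  have hev := (hL₁.and (hΓL.and (hcoer'.and ((hDD' d hd κ hκ).and
    ((hmax e he κ hκ).and (hquad (R + 1) r hr κ hκ) hκ.le hκ.le) hκ.le (by positivity))
      hκ.le (by positivity)) hκ.le (by positivity)) hκ.le (by positivity))
  have hκsum : κ + (κ + (κ + (κ + (κ + κ)))) = ε := by rw [hκdef]; ring
  rw [hκsum] at hev
  refine hev.mono ?_
  filter_upwards [eventually_forall_mem_inter_compact_exists_dist_lt h𝕋 hUT
      (isCompact_closedBall (0 : Vec p) R) hη',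
    eventually_forall_mem_compact_exists_dist_lt h𝕋
      ((isCompact_closedBall (0 : Vec p) R).inter_left (isClosed_limitSet UT)) inter_subset_left
      hη'] with T hVU hUV ω hω
  obtain ⟨hDω, hΓω, hcω, hDDω, hmaxω, hquadω⟩ := hω
  have hDL : ‖D T ω‖ ≤ L := hDω.trans ((le_max_left _ _).trans (le_max_right _ _))
  -- The quadratic estimate is available at `x T ω` without a bound on its norm, which avoids
  -- circularity; comparing with `u = 0` then supplies the bound.
  have hxρ : ‖x T ω‖ ≤ ρ := by
    refine norm_le_of_almost_maximal (hquadω _ (hx T ω) (Or.inr rfl)) ?_ hDL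
      (hDDω.le.trans hd1) hc hrc (hcω _)
    have := hmaxω 0 (h0 T)
    rw [hF0] at this
    linarith
  exact exists_near_almost_maximal (fun u hu huR => hquadω u hu (Or.inl huR)) (hx T ω) hmaxω hxρ hR
    hDL hΓω hDDω.le hr.le hVU hUV hη'1 hη'η hsum

/-- Exact maximizers over `U` of a quadratic field whose score is close to `D`. -/
theorem isAsympMaximizer_of_isMaxOn {Ω : Type*} [MeasurableSpace Ω] {μ : Measure Ω}
    {p : ℕ} {ι : Type*} {l : Filter ι} {U : Set (Vec p)} {D D' : ι → Ω → Vec p} {Γ : Ω → Mat p}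
    (hDD' : ∀ d > 0, ∀ κ > 0, EventuallyProb μ l κ fun i ω => ‖D' i ω - D i ω‖ < d)
    {y : ι → Ω → Vec p} (hy : ∀ᶠ i in l, ∀ ω, y i ω ∈ U)
    (htight : ∀ κ > 0, ∃ R : ℝ, EventuallyProb μ l κ fun i ω => ‖y i ω‖ ≤ R)
    (hmax : ∀ᶠ i in l, ∀ᵐ ω ∂μ, IsMaxOn (quadField (D' i ω) (Γ ω)) U (y i ω)) :
    IsAsympMaximizer μ l U D Γ y := by
  intro ε hε
  obtain ⟨R₀, hR₀⟩ := htight (ε / 2) (half_pos hε)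
  refine ⟨max R₀ 0, fun R hR η hη => ?_⟩
  have hR0 : 0 ≤ R := (le_max_right _ _).trans hR
  have hmax' : EventuallyProb μ l 0 fun i ω => IsMaxOn (quadField (D' i ω) (Γ ω)) U (y i ω) := by
    filter_upwards [hmax] with i hi
    simpa [ae_iff] using hi
  have h := (hR₀.and ((hDD' (η / (2 * (R + 1))) (by positivity) (ε / 2) (half_pos hε)).and hmax'
    (half_pos hε).le le_rfl) (half_pos hε).le (by positivity))
  rw [show ε / 2 + (ε / 2 + 0) = ε by ring] at h
  refine h.mono ?_
  filter_upwards [hy] with i hyi ω hω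
  obtain ⟨hyR₀, hd, hm⟩ := hω
  have hyR : ‖y i ω‖ ≤ R := hyR₀.trans ((le_max_left _ _).trans hR)
  refine ⟨y i ω, ⟨hyi ω, by simpa using hyR⟩, by simpa using hη.le, fun u hu => ?_⟩
  have huR : ‖u‖ ≤ R := by simpa using hu.2
  have h1 : quadField (D' i ω) (Γ ω) u ≤ quadField (D' i ω) (Γ ω) (y i ω) := hm hu.1
  rw [quadField_eq_exp_logQuad, quadField_eq_exp_logQuad, Real.exp_le_exp] at h1
  have hscore : ∀ v : Vec p, ‖v‖ ≤ R →
      |logQuad (D' i ω) (Γ ω) v - logQuad (D i ω) (Γ ω) v| ≤ η / 2 := fun v hv => by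
    calc _ ≤ ‖D' i ω - D i ω‖ * ‖v‖ := abs_logQuad_sub_le_of_score _ _ _ _
      _ ≤ η / (2 * (R + 1)) * (R + 1) := by gcongr; linarith
      _ = η / 2 := by field_simp
  linarith [(abs_le.1 (hscore u huR)).1, (abs_le.1 (hscore _ hyR)).2]

/-! ### Stable limit and asymptotic equivalence. -/

/-- Stable convergence of asymptotic maximizers to the unique maximizer of the limit field. -/
theorem stableTendsto_of_isAsympMaximizer {Ω ι : Type*} {𝒢 : MeasurableSpace Ω}
    [mΩ : MeasurableSpace Ω] {p : ℕ} {μ : Measure Ω} [IsProbabilityMeasure μ] {l : Filter ι}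
    {U : Set (Vec p)} {D : ι → Ω → Vec p} {Δ : Ω → Vec p} {Γ : Ω → Mat p} {w : Ω → Vec p}
    (h𝒢 : 𝒢 ≤ mΩ) (hD : StableTendsto 𝒢 μ D l Δ)
    (hDm : ∀ i, Measurable (D i)) (hΔm : Measurable Δ) (hΓ : Measurable[𝒢] fun ω i j => Γ ω i j)
    (hU : IsClosed U) (h0 : 0 ∈ U) (hw : Measurable w) (hwU : ∀ ω, w ω ∈ U)
    (hmax : ∀ᵐ ω ∂μ, ∀ u ∈ U, u ≠ w ω → logQuad (Δ ω) (Γ ω) u < logQuad (Δ ω) (Γ ω) (w ω))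
    {x : ι → Ω → Vec p} (hx : IsAsympMaximizer μ l U D Γ x) (hxm : ∀ i, Measurable (x i)) :
    StableTendsto 𝒢 μ x l w := by
  have key : ∀ (f : Vec p →ᵇ ℝ) (Z : Ω → ℝ) (C : ℝ), Measurable[𝒢] Z → 0 ≤ C → (∀ ω, 0 ≤ Z ω) →
      (∀ ω, Z ω ≤ C) → Tendsto (fun i => ∫ ω, f (x i ω) * Z ω ∂μ) l
        (𝓝 (∫ ω, f (w ω) * Z ω ∂μ)) := by
    intro f Z C hZ hC hZ0 hZC
    have hfB : ∀ v, |f v| ≤ ‖f‖ := fun v => f.norm_coe_le_norm v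
    rw [Metric.tendsto_nhds]
    intro ε hε
    filter_upwards [
      eventually_integral_asympMaximizer_le h𝒢 hD hDm hΔm hΓ hU h0 hw hwU hmax hx hx
        (Eventually.of_forall hxm) (Eventually.of_forall hxm)
        (g := fun z => f z.1) (f.continuous.comp continuous_fst) (norm_nonneg f)
        (fun z => hfB z.1) hZ hC hZ0 hZC (half_pos hε),
      eventually_integral_asympMaximizer_le h𝒢 hD hDm hΔm hΓ hU h0 hw hwU hmax hx hx
        (Eventually.of_forall hxm) (Eventually.of_forall hxm)
        (g := fun z => -f z.1) (f.continuous.comp continuous_fst).neg (norm_nonneg f)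
        (fun z => by rw [abs_neg]; exact hfB z.1) hZ hC hZ0 hZC (half_pos hε)] with i h1 h2
    simp only [neg_mul, integral_neg] at h2
    rw [Real.dist_eq, abs_lt]
    constructor <;> linarith
  -- The one-sided bound requires a nonnegative multiplier, hence the decomposition `Z = (Z + |C|) -
  -- |C|`.
  rintro f Z hZ ⟨C, hC⟩
  have hC' : ∀ ω, |Z ω| ≤ |C| := fun ω => (hC ω).trans (le_abs_self C)
  have h1 := key f (fun ω => Z ω + |C|) (2 * |C|) (hZ.add_const _) (by positivity)
    (fun ω => by linarith [(abs_le.1 (hC' ω)).1]) (fun ω => by linarith [(abs_le.1 (hC' ω)).2])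
  have h2 := key f (fun _ => |C|) |C| measurable_const (abs_nonneg C) (fun _ => abs_nonneg C)
    (fun _ => le_rfl)
  have hdecomp : ∀ v : Ω → Vec p, Measurable v → ∫ ω, f (v ω) * Z ω ∂μ =
      ∫ ω, f (v ω) * (Z ω + |C|) ∂μ - ∫ ω, f (v ω) * |C| ∂μ := by
    intro v hv
    have hfv : Measurable fun ω => f (v ω) := f.continuous.measurable.comp hv
    have hZm : Measurable Z := hZ.mono h𝒢 le_rfl
    rw [← integral_sub]
    · exact integral_congr_ae (ae_of_all _ fun ω => by simp only; ring)
    · exact integrable_mul_of_abs_le hfv (fun ω => f.norm_coe_le_norm _) (hZm.add_const _)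
        (C := 2 * |C|) fun ω => (abs_add_le _ _).trans (by rw [abs_abs]; linarith [hC' ω])
    · exact integrable_mul_of_abs_le hfv (fun ω => f.norm_coe_le_norm _) measurable_const
        (C := |C|) fun ω => (abs_abs C).le
  simp only [fun i => hdecomp (x i) (hxm i), hdecomp w hw]
  exact h1.sub h2

/-- Two families of asymptotic maximizers are asymptotically equivalent. -/
theorem tendstoInMeasure_sub_of_isAsympMaximizer {Ω ι : Type*} {𝒢 : MeasurableSpace Ω}
    [mΩ : MeasurableSpace Ω] {p : ℕ} {μ : Measure Ω} [IsProbabilityMeasure μ] {l : Filter ι}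
    {U : Set (Vec p)} {D : ι → Ω → Vec p} {Δ : Ω → Vec p} {Γ : Ω → Mat p} {w : Ω → Vec p}
    (h𝒢 : 𝒢 ≤ mΩ) (hD : StableTendsto 𝒢 μ D l Δ)
    (hDm : ∀ i, Measurable (D i)) (hΔm : Measurable Δ) (hΓ : Measurable[𝒢] fun ω i j => Γ ω i j)
    (hU : IsClosed U) (h0 : 0 ∈ U) (hw : Measurable w) (hwU : ∀ ω, w ω ∈ U)
    (hmax : ∀ᵐ ω ∂μ, ∀ u ∈ U, u ≠ w ω → logQuad (Δ ω) (Γ ω) u < logQuad (Δ ω) (Γ ω) (w ω))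
    {x y : ι → Ω → Vec p} (hx : IsAsympMaximizer μ l U D Γ x) (hy : IsAsympMaximizer μ l U D Γ y)
    (hxm : ∀ᶠ i in l, Measurable (x i)) (hym : ∀ᶠ i in l, Measurable (y i)) :
    TendstoInMeasure μ (fun i ω => x i ω - y i ω) l 0 := by
  rw [tendstoInMeasure_iff_norm]
  intro ε hε
  -- As `g` vanishes at `(w, w)`, its mean at `(x, y)` tends to zero, and Markov's inequality
  -- concludes.
  set g : Vec p × Vec p → ℝ := fun z => min 1 ‖z.1 - z.2‖ with hg
  have hgc : Continuous g := by fun_prop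
  have hg0 : ∀ z, 0 ≤ g z := fun z => le_min zero_le_one (norm_nonneg _)
  have hgabs : ∀ z, |g z| ≤ 1 := fun z => (abs_of_nonneg (hg0 z)).trans_le (min_le_left _ _)
  set m := min 1 ε with hm
  have hm0 : 0 < m := lt_min one_pos hε
  rw [ENNReal.tendsto_nhds_zero]
  intro δ hδ
  obtain ⟨κ, hκ0, hκδ⟩ : ∃ κ : ℝ, 0 < κ ∧ ENNReal.ofReal κ ≤ δ := by
    rcases eq_or_ne δ ⊤ with rfl | hδt
    · exact ⟨1, one_pos, le_top⟩
    · exact ⟨δ.toReal, ENNReal.toReal_pos hδ.ne' hδt, ENNReal.ofReal_toReal_le⟩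
  filter_upwards [hxm, hym, eventually_integral_asympMaximizer_le h𝒢 hD hDm hΔm hΓ hU h0 hw hwU
    hmax hx hy hxm hym hgc zero_le_one hgabs (Z := fun _ => 1) measurable_const zero_le_one
    (fun _ => zero_le_one) (fun _ => le_rfl) (mul_pos hm0 hκ0)] with i hxi hyi hi
  have hgm : Measurable fun ω => g (x i ω, y i ω) := hgc.measurable.comp (hxi.prodMk hyi)
  have hint : Integrable (fun ω => g (x i ω, y i ω)) μ :=
    Integrable.of_bound hgm.aestronglyMeasurable 1 (ae_of_all _ fun ω => hgabs _)
  have hgw : ∀ ω, g (w ω, w ω) = 0 := fun ω => by simp [hg]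
  simp only [mul_one, hgw, integral_zero, zero_add] at hi
  have hmarkov := mul_meas_ge_le_integral_of_nonneg (ae_of_all μ fun ω => hg0 (x i ω, y i ω))
    hint m
  have hreal : μ.real {ω | m ≤ g (x i ω, y i ω)} ≤ κ :=
    le_of_mul_le_mul_left (hmarkov.trans hi) hm0
  have hsub : {ω | ε ≤ ‖x i ω - y i ω - (0 : Ω → Vec p) ω‖} ⊆ {ω | m ≤ g (x i ω, y i ω)} := by
    intro ω hω
    have hω' : ε ≤ ‖x i ω - y i ω‖ := by simpa using hω
    exact min_le_min le_rfl hω'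
  refine (measure_mono hsub).trans (le_trans ?_ hκδ)
  rw [← ENNReal.ofReal_toReal (measure_ne_top μ {ω | m ≤ g (x i ω, y i ω)})]
  exact ENNReal.ofReal_le_ofReal hreal

/-! ### Local quadratic approximation and assembly of the theorem. -/

lemma measurable_of_measurable_entries {Ω : Type*} [MeasurableSpace Ω] {p : ℕ} {Γ : Ω → Mat p}
    (hΓ : ∀ i j, Measurable fun ω => Γ ω i j) : Measurable fun ω i j => Γ ω i j :=
  measurable_pi_iff.2 fun i => measurable_pi_iff.2 fun j => hΓ i j

/-- The random fields are locally asymptotically quadratic at the scale of the rate matrices. -/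
lemma eventuallyProb_abs_sub_logQuad_le {Ω β : Type*} [MeasurableSpace Ω] {μ : Measure Ω}
    {p : ℕ} {𝕋 : Set ℝ} {Θ : Set (Vec p)} {𝒯 : Set β} {θs : Vec p} {𝒩 : Set (Vec p)}
    (h𝒩 : IsOpen 𝒩) (hθs : θs ∈ closure 𝒩)
    (hnear : ∃ δ > 0, Θ ∩ {θ | ‖θ - θs‖ < δ} ⊆ closure 𝒩)
    (hstar : ∀ θ ∈ 𝒩, ∀ t : ℝ, 0 < t → t ≤ 1 → t • θ + (1 - t) • θs ∈ 𝒩)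
    {H : 𝕋 → Ω → Vec p → β → ℝ}
    (hH : ∀ T ω, ∀ τ ∈ 𝒯, IsC2OnClosure 𝒩 fun θ => H T ω θ τ)
    {a : 𝕋 → Mat p} (ha : ∀ T, IsUnit (a T).det)
    (ha0 : Tendsto (fun T => frobNorm (a T)) atTop (𝓝 0))
    {Γ : Ω → Mat p}
    (hhess : ∀ δ : 𝕋 → ℝ, (∀ T, 0 < δ T) → Tendsto δ atTop (𝓝 0) →
      TendstoZeroInProb μ
        (fun T ω => ⨆ θ ∈ closure 𝒩 ∩ {θ | ‖θ - θs‖ < δ T}, ⨆ τ ∈ 𝒯, ENNReal.ofReal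
          (frobNorm ((a T)ᵀ * hessExt 𝒩 (fun θ' => H T ω θ' τ) θ * a T + Γ ω))) atTop)
    {τhat : 𝕋 → Ω → β} (hτ : ∀ T ω, τhat T ω ∈ 𝒯) {x : 𝕋 → Ω → Vec p} {δ₀ : 𝕋 → ℝ}
    (hδ₀pos : ∀ T, 0 < δ₀ T) (hδ₀ : Tendsto δ₀ atTop (𝓝 0))
    (hx : ∀ κ > 0, EventuallyProb μ atTop κ fun T ω =>
      ‖Matrix.toEuclideanLin (a T) (x T ω)‖ < δ₀ T) (R : ℝ) {r : ℝ} (hr : 0 < r) {κ : ℝ}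
    (hκ : 0 < κ) :
    EventuallyProb μ atTop κ fun T ω => ∀ u ∈ localSet Θ θs (a T), ‖u‖ ≤ R ∨ u = x T ω →
      |H T ω (θs + Matrix.toEuclideanLin (a T) u) (τhat T ω) - H T ω θs (τhat T ω)
        - logQuad (scaledScore 𝒩 (a T) (fun θ => H T ω θ (τhat T ω)) θs) (Γ ω) u|
        ≤ r / 2 * ‖u‖ ^ 2 := by
  -- This radius covers both kinds of points: `δ₀ T` for `x T ω`, and `|R| * frobNorm (a T)` for all
  -- `u` with `‖u‖ ≤ R`.
  set δ : 𝕋 → ℝ := fun T => δ₀ T + |R| * frobNorm (a T) with hδ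
  have hδpos : ∀ T, 0 < δ T := fun T =>
    add_pos_of_pos_of_nonneg (hδ₀pos T) (mul_nonneg (abs_nonneg R) (frobNorm_nonneg _))
  have hδ0 : Tendsto δ atTop (𝓝 0) := by simpa using hδ₀.add (ha0.const_mul |R|)
  obtain ⟨δ₁, hδ₁, hΘ⟩ := hnear
  have h := (hx (κ / 2) (half_pos hκ)).and
    ((hhess δ hδpos hδ0).eventuallyProb_forall₂_lt hr (half_pos hκ)) (half_pos hκ).le
    (half_pos hκ).le
  rw [add_halves] at h
  refine h.mono ?_
  filter_upwards [hδ0.eventually_lt_const hδ₁] with T hT ω hω u hu hcase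
  have hau : ‖Matrix.toEuclideanLin (a T) u‖ < δ T := by
    rcases hcase with hR | rfl
    · have h1 := norm_toEuclideanLin_le (a T) u
      have h2 := mul_le_mul_of_nonneg_left (hR.trans (le_abs_self R)) (frobNorm_nonneg (a T))
      have h3 := hδ₀pos T
      simp only [hδ]
      linarith
    · have h2 := mul_nonneg (abs_nonneg R) (frobNorm_nonneg (a T))
      simp only [hδ]
      linarith [hω.1]
  have hmem : θs + Matrix.toEuclideanLin (a T) u ∈ closure 𝒩 :=
    hΘ ⟨hu, by simpa using hau.trans hT⟩
  exact abs_sub_sub_logQuad_le h𝒩 hstar hθs (hH T ω _ (hτ T ω)) (ha T)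
    (fun θ hθ hθδ => (hω.2 θ ⟨hθ, hθδ⟩ _ (hτ T ω)).le) hmem hau

theorem theorem4 {Ω : Type*} (𝒢 : MeasurableSpace Ω) [mΩ : MeasurableSpace Ω] (h𝒢 : 𝒢 ≤ mΩ)
    (μ : Measure Ω) [IsProbabilityMeasure μ] {p q : ℕ}
    -- the index set of `T`, unbounded in the reals
    (𝕋 : Set ℝ) (h𝕋 : ¬ BddAbove 𝕋)
    -- compact parameter spaces and the true value
    (Θ : Set (EuclideanSpace ℝ (Fin p))) (hΘ : IsCompact Θ)
    (𝒯 : Set (EuclideanSpace ℝ (Fin q))) (h𝒯 : IsCompact 𝒯)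
    (θs : EuclideanSpace ℝ (Fin p)) (hθs : θs ∈ Θ)
    -- the bounded open set on whose closure the field is `C²`
    (𝒩 : Set (EuclideanSpace ℝ (Fin p))) (h𝒩_open : IsOpen 𝒩)
    (h𝒩_bdd : Bornology.IsBounded 𝒩)
    (h𝒩_near : ∃ δ > 0, Θ ∩ {θ | ‖θ - θs‖ < δ} ⊆ closure 𝒩)
    (h𝒩_star : ∀ θ ∈ 𝒩, ∀ t : ℝ, 0 < t → t ≤ 1 → t • θ + (1 - t) • θs ∈ 𝒩)
    -- the continuous random fields `H_T` on `Θ × 𝒯`, extended to `closure 𝒩 × 𝒯`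
    (H : 𝕋 → Ω → EuclideanSpace ℝ (Fin p) → EuclideanSpace ℝ (Fin q) → ℝ)
    (hH_meas : ∀ T, ∀ θ ∈ Θ ∪ closure 𝒩, ∀ τ ∈ 𝒯, Measurable fun ω => H T ω θ τ)
    (hH_cont : ∀ T ω, ContinuousOn (Function.uncurry (H T ω)) (Θ ×ˢ 𝒯))
    (hH_cont_ext : ∀ T ω, ContinuousOn (Function.uncurry (H T ω)) (closure 𝒩 ×ˢ 𝒯))
    (hH_C2 : ∀ T ω, ∀ τ ∈ 𝒯, IsC2OnClosure 𝒩 fun θ => H T ω θ τ)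
    -- the rate matrices
    (a : 𝕋 → Matrix (Fin p) (Fin p) ℝ) (ha : ∀ T, IsUnit (a T).det)
    (ha_zero : Tendsto (fun T => frobNorm (a T)) atTop (𝓝 0))
    -- the nuisance estimator and the asymptotic maximizer
    (τhat : 𝕋 → Ω → EuclideanSpace ℝ (Fin q)) (hτhat_meas : ∀ T, Measurable (τhat T))
    (hτhat_mem : ∀ T ω, τhat T ω ∈ 𝒯)
    (θhat : 𝕋 → Ω → EuclideanSpace ℝ (Fin p)) (hθhat_meas : ∀ T, Measurable (θhat T))
    (hθhat_mem : ∀ T ω, θhat T ω ∈ Θ)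
    (hθhat_max : TendstoZeroInProb μ
      (fun T ω => ⨆ θ ∈ Θ,
        ENNReal.ofReal (H T ω θ (τhat T ω) - H T ω (θhat T ω) (τhat T ω))) atTop)
    -- the limits of the score, of minus the Hessian, and of the contrast
    (Δ : Ω → EuclideanSpace ℝ (Fin p)) (hΔ_meas : Measurable Δ)
    (Γ : Ω → Matrix (Fin p) (Fin p) ℝ) (hΓ_meas : ∀ i j, Measurable[𝒢] fun ω => Γ ω i j)
    (Y : Ω → EuclideanSpace ℝ (Fin p) → ℝ) (hY_meas : ∀ θ ∈ Θ, Measurable fun ω => Y ω θ)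
    (hY_cont : ∀ ω, ContinuousOn (Y ω) Θ)
    -- [B1]
    (hB1_unif : TendstoZeroInProb μ
      (fun T ω => ⨆ θ ∈ Θ, ⨆ τ ∈ 𝒯, ENNReal.ofReal
        |1 / lambdaMin (((a T)ᵀ * a T)⁻¹) * (H T ω θ τ - H T ω θs τ) - Y ω θ|) atTop)
    (hB1_neg : ∀ᵐ ω ∂μ, ∀ θ ∈ Θ, θ ≠ θs → Y ω θ < 0)
    -- [B2]
    (hB2_score : ∃ τ₀ ∈ 𝒯,
      TendstoZeroInProb μ
        (fun T ω => ⨆ τ ∈ 𝒯, ENNReal.ofReal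
          ‖scaledScore 𝒩 (a T) (fun θ => H T ω θ τ) θs
            - scaledScore 𝒩 (a T) (fun θ => H T ω θ τ₀) θs‖) atTop ∧
      StableTendsto 𝒢 μ (fun T ω => scaledScore 𝒩 (a T) (fun θ => H T ω θ τ₀) θs) atTop Δ)
    (hB2_hess : ∀ δ : 𝕋 → ℝ, (∀ T, 0 < δ T) → Tendsto δ atTop (𝓝 0) →
      TendstoZeroInProb μ
        (fun T ω => ⨆ θ ∈ closure 𝒩 ∩ {θ | ‖θ - θs‖ < δ T}, ⨆ τ ∈ 𝒯, ENNReal.ofReal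
          (frobNorm ((a T)ᵀ * hessExt 𝒩 (fun θ' => H T ω θ' τ) θ * a T + Γ ω))) atTop)
    -- [B3]
    (hB3 : ∀ᵐ ω ∂μ, (Γ ω).PosDef)
    -- [A3]
    (hA3 : outerLimitSet (fun T => localSet Θ θs (a T)) ⊆ limitSet fun T => localSet Θ θs (a T))
    -- [A4]
    (uhat : Ω → EuclideanSpace ℝ (Fin p)) (huhat_meas : Measurable uhat)
    (huhat_mem : ∀ ω, uhat ω ∈ limitSet fun T => localSet Θ θs (a T))
    (hA4_max : ∀ᵐ ω ∂μ,
      IsMaxOn (quadField (Δ ω) (Γ ω)) (limitSet fun T => localSet Θ θs (a T)) (uhat ω))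
    (hA4_unique : ∀ᵐ ω ∂μ, ∀ u ∈ limitSet fun T => localSet Θ θs (a T), u ≠ uhat ω →
      quadField (Δ ω) (Γ ω) u < quadField (Δ ω) (Γ ω) (uhat ω)) :
    StableTendsto 𝒢 μ
      (fun T ω => Matrix.toEuclideanLin (a T)⁻¹ (θhat T ω - θs)) atTop uhat ∧
    -- under [A5]
    ∀ (T₀ : 𝕋) (vhat : 𝕋 → Ω → EuclideanSpace ℝ (Fin p)),
      (∀ T, T₀ ≤ T → Measurable (vhat T)) →
      (∀ T, T₀ ≤ T → ∀ ω, vhat T ω ∈ limitSet fun T => localSet Θ θs (a T)) →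
      (∀ T, T₀ ≤ T → ∀ᵐ ω ∂μ,
        IsMaxOn (quadField (scaledScore 𝒩 (a T) (fun θ => H T ω θ (τhat T ω)) θs) (Γ ω))
          (limitSet fun T => localSet Θ θs (a T)) (vhat T ω)) →
      IsTightMeasureSet ((fun T => μ.map (vhat T)) '' Set.Ici T₀) →
      TendstoInMeasure μ
        (fun T ω => Matrix.toEuclideanLin (a T)⁻¹ (θhat T ω - θs) - vhat T ω) atTop 0 := by
  have hθsN : θs ∈ closure 𝒩 := by
    obtain ⟨δ, hδ, h⟩ := h𝒩_near
    exact h ⟨hθs, by simpa using hδ⟩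
  obtain ⟨τ₀, hτ₀, hscore, hstable⟩ := hB2_score
  set UT : 𝕋 → Set (Vec p) := fun T => localSet Θ θs (a T) with hUT
  set D : 𝕋 → Ω → Vec p := fun T ω => scaledScore 𝒩 (a T) (fun θ => H T ω θ τ₀) θs with hD
  set D' : 𝕋 → Ω → Vec p :=
    fun T ω => scaledScore 𝒩 (a T) (fun θ => H T ω θ (τhat T ω)) θs with hD'
  set x : 𝕋 → Ω → Vec p := fun T ω => Matrix.toEuclideanLin (a T)⁻¹ (θhat T ω - θs) with hx
  have hax : ∀ T ω, Matrix.toEuclideanLin (a T) (x T ω) = θhat T ω - θs := fun T ω =>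
    toEuclideanLin_mul_inv_cancel (ha T) _
  have hxm : ∀ T, Measurable (x T) := fun T =>
    ((LinearMap.continuous_of_finiteDimensional _).measurable).comp
      ((hθhat_meas T).sub_const θs)
  have hxU : ∀ T ω, x T ω ∈ UT T := fun T ω => by
    simp only [hUT, localSet, mem_ofPred_eq, hax, add_sub_cancel]
    exact hθhat_mem T ω
  have h0T : ∀ T, (0 : Vec p) ∈ UT T := fun T => by
    simpa only [hUT, localSet, mem_ofPred_eq, map_zero, add_zero] using hθs
  have hU : IsClosed (limitSet UT) := isClosed_limitSet UT
  have h0 : (0 : Vec p) ∈ limitSet UT := mem_limitSet_of_forall_mem h0T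
  have hDm : ∀ T, Measurable (D T) := fun T =>
    measurable_scaledScore h𝒩_open
      (fun θ hθ => hH_meas T θ (Or.inr (subset_closure hθ)) τ₀ hτ₀)
      (fun ω => hH_C2 T ω τ₀ hτ₀) hθsN (a T)
  have hΓpi : Measurable[𝒢] fun ω i j => Γ ω i j :=
    @measurable_of_measurable_entries Ω 𝒢 p Γ hΓ_meas
  have hΓm : Measurable fun ω i j => Γ ω i j := hΓpi.mono h𝒢 le_rfl
  -- The fixed parameter `τ₀` gives the measurable, stably convergent score `D`; the score `D'` at
  -- `τhat` that occurs in the expansion differs from it negligibly.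
  have hDD' : ∀ d > 0, ∀ κ > 0, EventuallyProb μ atTop κ fun T ω => ‖D' T ω - D T ω‖ < d :=
    fun d hd κ hκ => (hscore.eventuallyProb_forall_lt hd hκ).mono
      (Eventually.of_forall fun T ω hω => hω _ (hτhat_mem T ω))
  have hgap : ∀ c > 0, ∀ κ > 0, EventuallyProb μ atTop κ fun T ω =>
      ∀ θ ∈ Θ, H T ω θ (τhat T ω) - H T ω (θhat T ω) (τhat T ω) < c :=
    fun c hc κ hκ => hθhat_max.eventuallyProb_forall_lt hc hκ
  have hb : ∀ᶠ T in atTop, 1 / lambdaMin ((a T)ᵀ * a T)⁻¹ ∈ Icc (0 : ℝ) 1 := by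
    have hsq : Tendsto (fun T => frobNorm (a T) ^ 2) atTop (𝓝 0) := by
      simpa using ha_zero.pow 2
    filter_upwards [hsq.eventually_le_const one_pos] with T hT
    have h := one_div_lambdaMin_mem_Icc (ha T)
    exact ⟨h.1, h.2.trans hT⟩
  obtain ⟨δ₀, hδ₀pos, hδ₀, hδ₀X⟩ := exists_rate_of_tendsto_prob (μ := μ) h𝕋
    (X := fun T ω => ‖θhat T ω - θs‖) fun ε hε κ hκ =>
      eventuallyProb_norm_sub_lt_of_contrast hΘ hθs hτhat_mem hθhat_mem hgap hY_meas hY_cont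
        hB1_neg hb (fun c hc κ hκ => hB1_unif.eventuallyProb_forall₂_lt (s := fun _ => Θ) hc hκ)
        hε hκ
  have hxasymp : IsAsympMaximizer μ atTop (limitSet UT) D Γ x := by
    refine isAsympMaximizer_of_locally_quadratic h𝕋 hA3 h0T
      (F := fun T ω u => H T ω (θs + Matrix.toEuclideanLin (a T) u) (τhat T ω)
        - H T ω θs (τhat T ω)) (fun T ω => by simp)
      (fun κ hκ => hstable.exists_eventuallyProb_norm_le hDm hΔ_meas hκ) hDD' hΓm hB3 hxU
      (fun e he κ hκ => (hgap e he κ hκ).mono (Eventually.of_forall fun T ω hω u hu => ?_))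
      (fun R r hr κ hκ => eventuallyProb_abs_sub_logQuad_le h𝒩_open hθsN h𝒩_near h𝒩_star hH_C2 ha
        ha_zero hB2_hess hτhat_mem hδ₀pos hδ₀ (by simpa only [hax] using hδ₀X) R hr hκ)
    have h1 := hω _ hu
    simp only [hax, add_sub_cancel]
    linarith
  have hmax : ∀ᵐ ω ∂μ, ∀ u ∈ limitSet UT, u ≠ uhat ω →
      logQuad (Δ ω) (Γ ω) u < logQuad (Δ ω) (Γ ω) (uhat ω) := by
    filter_upwards [hA4_unique] with ω hω u hu hne
    have := hω u hu hne
    rwa [quadField_eq_exp_logQuad, quadField_eq_exp_logQuad, Real.exp_lt_exp] at this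
  refine ⟨stableTendsto_of_isAsympMaximizer h𝒢 hstable hDm hΔ_meas hΓpi hU h0 huhat_meas huhat_mem
    hmax hxasymp hxm, fun T₀ vhat hvm hvU hvmax hvtight => ?_⟩
  have hge : ∀ᶠ T in atTop, T₀ ≤ T := eventually_ge_atTop T₀
  have hvasymp : IsAsympMaximizer μ atTop (limitSet UT) D Γ vhat := by
    refine isAsympMaximizer_of_isMaxOn hDD' (hge.mono hvU) (fun κ hκ => ?_) (hge.mono hvmax)
    obtain ⟨K, hK, hKv⟩ := isTightMeasureSet_iff_exists_isCompact_measure_compl_le.1 hvtight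
      (ENNReal.ofReal κ) (by simpa using hκ)
    obtain ⟨R, hR⟩ := hK.isBounded.exists_norm_le
    refine ⟨R, ?_⟩
    filter_upwards [hge] with T hT
    have h1 := hKv _ (mem_image_of_mem _ hT)
    rw [Measure.map_apply (hvm T hT) hK.measurableSet.compl] at h1
    exact (measure_mono fun ω (hω : ¬ ‖vhat T ω‖ ≤ R) hmem => hω (hR _ hmem)).trans h1
  exact tendstoInMeasure_sub_of_isAsympMaximizer h𝒢 hstable hDm hΔ_meas hΓpi hU h0 huhat_meas
    huhat_mem hmax hxasymp hvasymp (Eventually.of_forall hxm) (hge.mono hvm)
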